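/- Let $C$ be an algebraically closed field of characteristic zero, and let $C(x)[D]$ be the ring of linear differential operators with rational function coefficients, with $Dx=xD+1$. Write $V(A)$ for the solution space of an operator $A$ in $C((x))$, and $(V(M):V(L))=\{h\in C((x)) : h\,V(L)\subseteq V(M)\}$. An operator is called primitive if its coefficients are coprime polynomials in $C[x]$ and its leading coefficient is monic. For nonzero operators $A,B$ the symmetric product $A\otimes B$ is the primitive operator of lowest order that annihilates $fg$ whenever $f$ is a solution of $A$ and $g$ is a solution of $B$ in a common (commutative) differential ring extension of $C(x)$; $A^{\otimes s}$ denotes the $s$-fold symmetric product, with $A^{\otimes 0}=D$ and $A^{\otimes 1}=A$. We say that $S$ is a right factor of $M$ if $M=RS$ for some $R\in C(x)[D]$. The global quasi-symmetric quotient of $M$ by $L$ is the unique primitive operator $Q\in C(x)[D]$ of maximal order such that $L\otimes Q$ is a right factor of $M$. Consider the following algorithm for $L,M\in C(x)[D]$ of positive order. Choose an arbitrary $\xi\in C$ that is an ordinary point of both $L$ and $M$, substitute $x\to x+\xi$ in $L$ and $M$, run the procedure below on the resulting operators (again written $L,M$); if it answers None, answer Fail, otherwise substitute $x\to x-\xi$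 in its result and return this. The procedure is: 1. Let $r=\operatorname{ord}(L)$ and $\delta=\dim_C (V(M):V(L))$. If $\delta=0$, return $1$. 2. Otherwise let $N=M\otimes L^{\otimes(r-1)}$, let $z$ be the largest nonnegative integer root of the indicial polynomial of $N$ at $0$, set $k:=z-\frac{r(r-1)}2+1$, and let $d_0\in\mathbb N$ be any upper bound for the degrees of the coefficients of the global quasi-symmetric quotient of $M$ by $L$ in case that its order is $\delta$. 3. Take any basis of $(V(M):V(L))$ and let $h_1,\dots,h_\delta$ be its elements truncated after the term $x^k$. Put $d=\min\{d_0,\lfloor (k-\delta)/(\delta+1)\rfloor\}$. Let $Q$ be any primitive operator $q_0+q_1D+\dots+q_\delta D^\delta$ with $\deg q_i\le d$ and $Q\cdot h_j=O(x^{k-\delta})$ for all $j$, or $Q=\emptyset$ if there is none. 4. If $Q=\emptyset$ and $k\ge(\delta+1)(d_0+1)+\delta$, return None. If $Q\ne\emptyset$, $\operatorname{ord}(Q)=\delta$ and $L\otimes Q$ is a right factor of $M$, return $Q$. Otherwise replace $k$ by $2k$ and go to step 3. **Theorem.** Let $L,M\in C[D]$ be operators with constant coefficients and of positive order. Then the global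 quasi-symmetric quotient $Q$ of $M$ by $L$ exists and lies in $C[D]$, and the algorithm returns it: for all choices made in the algorithm, each step can be carried out, the algorithm terminates, and its result is $Q$ (never Fail). -/

import Mathlib

open Polynomial LaurentSeries Differential

universe u

noncomputable section

/-! ### The differential fields `C(x)` and `C((x))` -/

section DifferentialFields

variable {C : Type u} [Field C]

/-- An additive map satisfying the Leibniz rule, as a derivation. -/
def additiveDerivation {R : Type u} [CommRing R] (d : R →+ R)
    (h : ∀ a b, d (a * b) = a * d b + b * d a) : Derivation ℤ R R :=
  Derivation.mk' d.toIntLinearMap h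

theorem deriv_div_eq {K : Type u} [Field K] [Differential K] (a b : K) :
    (a / b)′ = (b * a′ - a * b′) / b ^ 2 := by
  rw [Derivation.leibniz_div, smul_eq_mul, smul_eq_mul, smul_eq_mul, inv_pow, div_eq_inv_mul]

/-- The derivative `(p' q - p q') / q²` of a rational function `p / q` in lowest terms. -/
def ratDeriv (f : RatFunc C) : RatFunc C :=
  algebraMap C[X] (RatFunc C) (derivative f.num * f.denom - f.num * derivative f.denom) /
    algebraMap C[X] (RatFunc C) (f.denom ^ 2)

/-- The quotient rule for an arbitrary representation as a fraction. -/
theorem ratDeriv_div (p q : C[X]) (hq : q ≠ 0) :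
    ratDeriv (algebraMap C[X] (RatFunc C) p / algebraMap C[X] (RatFunc C) q) =
      algebraMap C[X] (RatFunc C) (derivative p * q - p * derivative q) /
        algebraMap C[X] (RatFunc C) (q ^ 2) := by
  set f : RatFunc C := algebraMap C[X] (RatFunc C) p / algebraMap C[X] (RatFunc C) q with hf
  have hd : f.denom ≠ 0 := f.denom_ne_zero
  have hinj := RatFunc.algebraMap_injective C
  have hqa : algebraMap C[X] (RatFunc C) q ≠ 0 := RatFunc.algebraMap_ne_zero hq
  have hda : algebraMap C[X] (RatFunc C) f.denom ≠ 0 := RatFunc.algebraMap_ne_zero hd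
  have h0 : f.num * q = p * f.denom := by
    apply hinj
    have h1 := RatFunc.num_div_denom f
    rw [hf, div_eq_div_iff hda hqa] at h1
    simpa only [map_mul] using h1
  have h1 : derivative f.num * q + f.num * derivative q =
      derivative p * f.denom + p * derivative f.denom := by
    have := congrArg derivative h0
    simpa only [derivative_mul] using this
  unfold ratDeriv
  rw [div_eq_div_iff (RatFunc.algebraMap_ne_zero (pow_ne_zero 2 hd))
    (RatFunc.algebraMap_ne_zero (pow_ne_zero 2 hq)), ← map_mul, ← map_mul]
  congr 1
  linear_combination (f.denom * q) * h1 - (derivative q * f.denom + derivative f.denom * q) * h0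

/-- `C(x)` as a differential field. -/
instance instDifferentialRatFunc : Differential (RatFunc C) where
  deriv := additiveDerivation
      { toFun := ratDeriv
        map_zero' := by simp [ratDeriv]
        map_add' := fun f g => by
          rw [← RatFunc.num_div_denom f, ← RatFunc.num_div_denom g]
          generalize f.num = p, g.num = r
          have hq : f.denom ≠ 0 := f.denom_ne_zero
          have hs : g.denom ≠ 0 := g.denom_ne_zero
          generalize f.denom = q at hq ⊢
          generalize g.denom = s at hs ⊢
          have hqa : algebraMap C[X] (RatFunc C) q ≠ 0 := RatFunc.algebraMap_ne_zero hq
          have hsa : algebraMap C[X] (RatFunc C) s ≠ 0 := RatFunc.algebraMap_ne_zero hs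
          rw [div_add_div _ _ hqa hsa, ← map_mul, ← map_mul, ← map_mul, ← map_add,
            ratDeriv_div _ _ (mul_ne_zero hq hs), ratDeriv_div _ _ hq, ratDeriv_div _ _ hs]
          simp only [derivative_mul, map_add, map_sub, map_mul, map_pow]
          field_simp
          ring }
    (fun f g => by
      change ratDeriv (f * g) = f * ratDeriv g + g * ratDeriv f
      rw [← RatFunc.num_div_denom f, ← RatFunc.num_div_denom g]
      generalize f.num = p, g.num = r
      have hq : f.denom ≠ 0 := f.denom_ne_zero
      have hs : g.denom ≠ 0 := g.denom_ne_zero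
      generalize f.denom = q at hq ⊢
      generalize g.denom = s at hs ⊢
      have hqa : algebraMap C[X] (RatFunc C) q ≠ 0 := RatFunc.algebraMap_ne_zero hq
      have hsa : algebraMap C[X] (RatFunc C) s ≠ 0 := RatFunc.algebraMap_ne_zero hs
      rw [div_mul_div_comm, ← map_mul, ← map_mul,
        ratDeriv_div _ _ (mul_ne_zero hq hs), ratDeriv_div _ _ hq, ratDeriv_div _ _ hs]
      simp only [derivative_mul, map_add, map_sub, map_mul, map_pow]
      field_simp
      ring)

/-- The expansion of rational functions as Laurent series at `0`. -/
instance instAlgebraRatFuncLaurentSeries : Algebra (RatFunc C) C⸨X⸩ :=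
  RatFunc.liftAlgebra C C⸨X⸩

/-- The Leibniz rule for the formal derivative of Laurent series. -/
theorem laurentSeries_derivative_mul (f g : C⸨X⸩) :
    LaurentSeries.derivative C (f * g) =
      f * LaurentSeries.derivative C g + g * LaurentSeries.derivative C f := by
  have hx : ∀ (h : C⸨X⸩) (n : ℤ),
      (HahnSeries.single (1 : ℤ) (1 : C) * LaurentSeries.derivative C h).coeff n =
        (n : C) * h.coeff n := by
    intro h n
    have h1 := HahnSeries.coeff_single_mul_add (r := (1 : C)) (x := LaurentSeries.derivative C h)
      (a := n - 1) (b := (1 : ℤ))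
    rw [sub_add_cancel] at h1
    rw [h1]
    simp
  have hs : ∀ h : C⸨X⸩, (HahnSeries.single (1 : ℤ) (1 : C) *
      LaurentSeries.derivative C h).support ⊆ h.support := by
    intro h n hn h0
    apply hn
    rw [hx, h0, mul_zero]
  have h1 : (HahnSeries.single (1 : ℤ) (1 : C) : C⸨X⸩) ≠ 0 := by simp
  apply mul_left_cancel₀ h1
  have h2 : HahnSeries.single (1 : ℤ) (1 : C) *
      (f * LaurentSeries.derivative C g + g * LaurentSeries.derivative C f) =
      f * (HahnSeries.single (1 : ℤ) (1 : C) * LaurentSeries.derivative C g) +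
      (HahnSeries.single (1 : ℤ) (1 : C) * LaurentSeries.derivative C f) * g := by ring
  rw [h2]
  ext n
  rw [hx, HahnSeries.coeff_add, HahnSeries.coeff_mul, HahnSeries.coeff_mul_right' g.isPWO_support (hs g),
    HahnSeries.coeff_mul_left' f.isPWO_support (hs f), Finset.mul_sum, ← Finset.sum_add_distrib]
  refine Finset.sum_congr rfl fun ij hij => ?_
  rw [Finset.mem_antidiagonal] at hij
  rw [hx, hx, ← hij.2.2]
  push_cast
  ring

/-- `C((x))` as a differential field. -/
instance instDifferentialLaurentSeries : Differential C⸨X⸩ where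
  deriv := additiveDerivation (LaurentSeries.derivative C).toAddMonoidHom
    laurentSeries_derivative_mul

/-- `C((x))` is a differential extension of `C(x)`. -/
instance instDifferentialAlgebraLaurentSeries : DifferentialAlgebra (RatFunc C) C⸨X⸩ where
  deriv_algebraMap f := by
    have hp : ∀ p : C[X], (algebraMap (RatFunc C) C⸨X⸩ (algebraMap C[X] (RatFunc C) p))′ =
        algebraMap (RatFunc C) C⸨X⸩ (algebraMap C[X] (RatFunc C) (derivative p)) := by
      intro p
      rw [← IsScalarTower.algebraMap_apply, ← IsScalarTower.algebraMap_apply]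
      change LaurentSeries.derivative C (algebraMap C[X] C⸨X⸩ p) = _
      induction p using Polynomial.induction_on' with
      | add p q hp hq => simp only [map_add, hp, hq]
      | monomial n a =>
        rw [derivative_monomial, Polynomial.algebraMap_hahnSeries_apply,
          Polynomial.algebraMap_hahnSeries_apply, Polynomial.coe_monomial, Polynomial.coe_monomial]
        have hm : ∀ (k : ℕ) (b : C), (HahnSeries.ofPowerSeries ℤ C) (PowerSeries.monomial k b) =
            HahnSeries.single (k : ℤ) b := by
          intro k b
          rw [← mul_one b, ← smul_eq_mul, map_smul, ← PowerSeries.X_pow_eq,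
            PowerSeries.smul_eq_C_mul, map_mul, HahnSeries.ofPowerSeries_C,
            HahnSeries.ofPowerSeries_X_pow, HahnSeries.C_mul_eq_smul]
          ext i
          simp [HahnSeries.coeff_single]
        rw [hm, hm, LaurentSeries.derivative_apply, LaurentSeries.hasseDeriv_single]
        rcases n with _ | n
        · simp
        · simp [mul_comm]
    change _ = algebraMap (RatFunc C) C⸨X⸩ (ratDeriv f)
    conv_lhs => rw [← RatFunc.num_div_denom f]
    rw [ratDeriv, map_div₀ (algebraMap (RatFunc C) C⸨X⸩), deriv_div_eq, hp, hp,
      map_div₀ (algebraMap (RatFunc C) C⸨X⸩)]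
    simp only [map_sub, map_mul, map_pow]
    ring

end DifferentialFields

/-! ### Linear differential operators -/

/-- The operator `ℓ₀ + ℓ₁ D + ⋯ + ℓᵣ Dʳ` of `C(x)[D]` is stored as the polynomial with the same
coefficients (written to the left of the powers of `D`).  Its order is `natDegree`.  The product
of operators is `DiffOp.mulOp` below, not the commutative product of polynomials. -/
abbrev DiffOp (C : Type u) [Field C] : Type u := (RatFunc C)[X]

namespace DiffOp

variable {C : Type u} [Field C]

/-- The product `D B`, by the rule `D b = b D + b'`. -/
def derivComp (B : DiffOp C) : DiffOp C :=
  B.sum fun i b => monomial (i + 1) b + monomial i b′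

/-- The product `A B` in the Ore algebra `C(x)[D]`. -/
def mulOp (A B : DiffOp C) : DiffOp C :=
  A.sum fun i a => Polynomial.C a * derivComp^[i] B

/-- The action `L · f = ∑ ℓᵢ f⁽ⁱ⁾` on a differential ring extension of `C(x)`. -/
def act {F : Type u} [CommRing F] [Differential F] [Algebra (RatFunc C) F]
    (L : DiffOp C) (f : F) : F :=
  L.sum fun i a => algebraMap (RatFunc C) F a * (fun g : F => g′)^[i] f

theorem act_monomial {F : Type u} [CommRing F] [Differential F] [Algebra (RatFunc C) F]
    (n : ℕ) (a : RatFunc C) (f : F) :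
    act (monomial n a : DiffOp C) f = algebraMap (RatFunc C) F a * (fun g : F => g′)^[n] f :=
  Polynomial.sum_monomial_index _ _ (by simp)

theorem act_add {F : Type u} [CommRing F] [Differential F] [Algebra (RatFunc C) F]
    (A B : DiffOp C) (f : F) : act (A + B) f = A.act f + B.act f :=
  Polynomial.sum_add_index _ _ _ (by simp) (by intros; rw [map_add, add_mul])

theorem act_derivComp {F : Type u} [CommRing F] [Differential F] [Algebra (RatFunc C) F]
    [DifferentialAlgebra (RatFunc C) F] (B : DiffOp C) (f : F) :
    (derivComp B).act f = (B.act f)′ := by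
  unfold derivComp
  induction B using Polynomial.induction_on' with
  | add A B hA hB =>
    rw [Polynomial.sum_add_index _ _ _ (by simp) (by intros; simp only [map_add]; ring), act_add, hA, hB,
      act_add, map_add]
  | monomial n a =>
    rw [Polynomial.sum_monomial_index _ _ (by simp), act_add, act_monomial, act_monomial,
      act_monomial, Derivation.leibniz, deriv_algebraMap, Function.iterate_succ_apply']
    simp only [smul_eq_mul]
    ring

/-- The product of operators acts as the composition of the actions. -/
theorem act_mulOp {F : Type u} [CommRing F] [Differential F] [Algebra (RatFunc C) F]
    [DifferentialAlgebra (RatFunc C) F] (A B : DiffOp C) (f : F) :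
    (mulOp A B).act f = A.act (B.act f) := by
  have hC : ∀ (a : RatFunc C) (E : DiffOp C),
      act (Polynomial.C a * E) f = algebraMap (RatFunc C) F a * E.act f := by
    intro a E
    induction E using Polynomial.induction_on' with
    | add E G hE hG => rw [mul_add, act_add, act_add, hE, hG, mul_add]
    | monomial n b => rw [C_mul_monomial, act_monomial, act_monomial, map_mul, mul_assoc]
  have hD : ∀ n : ℕ, (derivComp^[n] B).act f = (fun g : F => g′)^[n] (B.act f) := by
    intro n
    induction n with
    | zero => rfl
    | succ n ih => rw [Function.iterate_succ_apply', act_derivComp, ih, Function.iterate_succ_apply']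
  induction A using Polynomial.induction_on' with
  | add E G hE hG =>
    unfold mulOp at hE hG ⊢
    rw [Polynomial.sum_add_index _ _ _ (by simp) (by intros; rw [map_add, add_mul]), act_add, hE,
      hG, act_add]
  | monomial n a =>
    unfold mulOp
    rw [Polynomial.sum_monomial_index _ _ (by simp), hC, hD, act_monomial]

/-- `S` is a right factor of `M`. -/
def IsRightFactor (S M : DiffOp C) : Prop := ∃ R : DiffOp C, M = mulOp R S

/-- The coefficients are coprime polynomials, the leading one being monic. -/
def IsPrimitiveOp (Q : DiffOp C) : Prop :=
  ∃ q : C[X][X], q.IsPrimitive ∧ q.leadingCoeff.Monic ∧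
    Q = q.map (algebraMap C[X] (RatFunc C))

/-- `L` lies in `C[D]`. -/
def HasConstCoeffs (L : DiffOp C) : Prop :=
  ∃ p : C[X], L = p.map RatFunc.C

/-- In every differential ring extension of `C(x)`, the operator `S` annihilates all products of a
solution of `L₁` and a solution of `L₂`. -/
def AnnihilatesProducts (L₁ L₂ S : DiffOp C) : Prop :=
  ∀ (F : Type u) [CommRing F] [Differential F] [Algebra (RatFunc C) F]
    [DifferentialAlgebra (RatFunc C) F] (f₁ f₂ : F),
    L₁.act f₁ = 0 → L₂.act f₂ = 0 → S.act (f₁ * f₂) = 0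

/-- `S` is the symmetric product `L₁ ⊗ L₂`: the primitive operator of lowest order annihilating
all products of solutions. -/
def IsSymProduct (L₁ L₂ S : DiffOp C) : Prop :=
  S.IsPrimitiveOp ∧ AnnihilatesProducts L₁ L₂ S ∧
    ∀ T : DiffOp C, T ≠ 0 → AnnihilatesProducts L₁ L₂ T → S.natDegree ≤ T.natDegree

/-- `S` is the symmetric power `L^{⊗ s}`; the empty power is `D`, the neutral element of `⊗`. -/
def IsSymPower (L : DiffOp C) : ℕ → DiffOp C → Prop
  | 0, S => S = X
  | 1, S => S = L
  | s + 2, S => ∃ P, IsSymPower L (s + 1) P ∧ IsSymProduct L P S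

/-- `L ⊗ Q` is a right factor of `M`. -/
def SymProductDivides (L Q M : DiffOp C) : Prop :=
  ∃ S, IsSymProduct L Q S ∧ IsRightFactor S M

/-- `Q` is a primitive operator of maximal order among those for which `L ⊗ Q` is a right factor
of `M`. -/
def IsMaximalQuotient (M L Q : DiffOp C) : Prop :=
  Q.IsPrimitiveOp ∧ SymProductDivides L Q M ∧
    ∀ P : DiffOp C, SymProductDivides L P M → P.natDegree ≤ Q.natDegree

/-- `Q` is the (global) quasi-symmetric quotient of `M` by `L`: the unique primitive operator of
maximal order such that `L ⊗ Q` is a right factor of `M`. -/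
def IsQuasiSymmetricQuotient (M L Q : DiffOp C) : Prop :=
  IsMaximalQuotient M L Q ∧ ∀ Q' : DiffOp C, IsMaximalQuotient M L Q' → Q' = Q

/-- `ξ` is not a pole of any `ℓᵢ / ℓᵣ`. -/
def IsOrdinaryPoint (L : DiffOp C) (ξ : C) : Prop :=
  ∀ i, (L.coeff i / L.leadingCoeff).denom.eval ξ ≠ 0

/-- The substitution `x ↦ x + ξ` in the coefficients. -/
def shift (ξ : C) (L : DiffOp C) : DiffOp C :=
  L.map (RatFunc.laurent ξ).toRingHom

/-- The solution space of `L` in `C((x))`. -/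
def solutionSpace (L : DiffOp C) : Submodule C C⸨X⸩ where
  carrier := {f | L.act f = 0}
  zero_mem' := by
    change L.act (0 : C⸨X⸩) = 0
    simp [act, Polynomial.sum, iterate_map_zero]
  add_mem' := by
    intro f g hf hg
    change L.act (f + g) = 0
    have h : L.act (f + g) = L.act f + L.act g := by
      simp [act, Polynomial.sum, iterate_map_add, mul_add, Finset.sum_add_distrib]
    rw [h, show L.act f = 0 from hf, show L.act g = 0 from hg, add_zero]
  smul_mem' := by
    intro c f hf
    change L.act (c • f) = 0
    have hd : ∀ n : ℕ, (fun g : C⸨X⸩ => g′)^[n] (c • f) = c • (fun g : C⸨X⸩ => g′)^[n] f := by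
      intro n
      induction n with
      | zero => rfl
      | succ n ih =>
        rw [Function.iterate_succ_apply', ih, Function.iterate_succ_apply']
        exact (LaurentSeries.derivative C).map_smul c _
    have h : L.act (c • f) = c • L.act f := by
      simp only [act, Polynomial.sum, hd, Finset.smul_sum]
      refine Finset.sum_congr rfl fun i _ => ?_
      rw [← HahnSeries.C_mul_eq_smul, ← HahnSeries.C_mul_eq_smul, mul_left_comm]
    rw [h, show L.act f = 0 from hf, smul_zero]

/-- The colon space `(V(M) : V(L)) = {h | h V(L) ⊆ V(M)}` in `C((x))`. -/
def colonSpace (M L : DiffOp C) : Submodule C C⸨X⸩ where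
  carrier := {h | ∀ g ∈ L.solutionSpace, h * g ∈ M.solutionSpace}
  zero_mem' := fun g _ => by simp
  add_mem' := fun ha hb g hg => by
    rw [add_mul]
    exact M.solutionSpace.add_mem (ha g hg) (hb g hg)
  smul_mem' := fun c h hh g hg => by
    rw [← HahnSeries.C_mul_eq_smul, mul_assoc, HahnSeries.C_mul_eq_smul]
    exact M.solutionSpace.smul_mem c (hh g hg)

/-- The polynomial `c_m` in `N · x^s = ∑ m, c_m(s) x^(s + m)`. -/
def shiftPoly (N : DiffOp C) (m : ℤ) : C[X] :=
  N.sum fun i a => Polynomial.C ((algebraMap (RatFunc C) C⸨X⸩ a).coeff (m + i)) *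
    descPochhammer C i

/-- `p` is the indicial polynomial of `N` at `0`, the first nonzero `c_m`. -/
def IsIndicialPoly (N : DiffOp C) (p : C[X]) : Prop :=
  ∃ σ : ℤ, p = N.shiftPoly σ ∧ p ≠ 0 ∧ ∀ m < σ, N.shiftPoly m = 0

/-- `z` is the largest nonnegative integer root of the indicial polynomial of `N` at `0`. -/
def IsMaxIndicialRoot (N : DiffOp C) (z : ℕ) : Prop :=
  ∃ p, N.IsIndicialPoly p ∧ IsGreatest {k : ℕ | p.eval (k : C) = 0} z

end DiffOp

/-! ### The subroutines -/

/-- The truncation `T_k`, keeping the coefficients of `x^i` for `i ≤ k`. -/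
def truncAt {C : Type u} [Field C] (k : ℤ) (f : C⸨X⸩) : C⸨X⸩ := HahnSeries.truncLT (k + 1) f

namespace SymDivision

open DiffOp

variable {C : Type u} [Field C]

/-- The value of `ColonSpaceDimension(M, L)`. -/
def colonDim (M L : DiffOp C) : ℕ := Module.finrank C (colonSpace M L)

/-- `h` is a possible result of `ColonSpaceBasis(M, L, k)`: a basis of the colon space, known at
precision `k`. -/
def IsColonSpaceBasisAt (M L : DiffOp C) (k : ℤ) {δ : ℕ} (h : Fin δ → C⸨X⸩) : Prop :=
  ∃ b : Module.Basis (Fin δ) C (colonSpace M L), ∀ j, h j = truncAt k (b j : C⸨X⸩)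

/-- `d₀` is a possible result of `BoundDegreeOfQuasiSymmetricQuotientCoeffs(M, L, δ)`: a bound for
the degrees of the coefficients of a quasi-symmetric quotient of order `δ`. -/
def IsCoeffDegreeBound (M L : DiffOp C) (δ d₀ : ℕ) : Prop :=
  ∀ Q : DiffOp C, IsQuasiSymmetricQuotient M L Q → Q.natDegree = δ →
    ∀ i, (Q.coeff i).num.natDegree ≤ d₀

/-- `Q = q₀ + ⋯ + q_δ D^δ` is primitive with `deg qᵢ ≤ sᵢ` and `Q · h_j = O(x^(k - δ))`. -/
def IsApproximantAnnihilator {δ : ℕ} (h : Fin δ → C⸨X⸩) (s : Fin (δ + 1) → ℤ) (k : ℤ)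
    (Q : DiffOp C) : Prop :=
  Q.IsPrimitiveOp ∧ Q.natDegree ≤ δ ∧
    (∀ i : Fin (δ + 1), ((Q.coeff i).num.natDegree : ℤ) ≤ s i) ∧
    ∀ j, ∀ m < k - δ, (Q.act (h j)).coeff m = 0

/-- The possible results of `ApproximantAnnihilator(h; s; k)`, where `none` stands for `∅`. -/
def ApproximantAnnihilatorResult {δ : ℕ} (h : Fin δ → C⸨X⸩) (s : Fin (δ + 1) → ℤ) (k : ℤ) :
    Option (DiffOp C) → Prop
  | some Q => IsApproximantAnnihilator h s k Q
  | none => ∀ Q, ¬ IsApproximantAnnihilator h s k Q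

/-- The call of `ApproximantAnnihilator` in one pass of the loop, with `d₀`, `k` and the order `δ`
given, on some basis returned by `ColonSpaceBasis(M, L, k)`. -/
def LoopBodyResult (M L : DiffOp C) (d₀ : ℕ) (k : ℤ) (res : Option (DiffOp C)) : Prop :=
  ∃ h : Fin (colonDim M L) → C⸨X⸩, IsColonSpaceBasisAt M L k h ∧
    ApproximantAnnihilatorResult h
      (fun _ => min (d₀ : ℤ) ((k - colonDim M L) / (colonDim M L + 1))) k res

/-! ### The algorithms as transition systems -/

/-- The states of `QuasiSymmetricQuotientAtZero`; in a loop state, `d₀` and the current `k` are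
recorded, and `returned none` stands for the answer *None*. -/
inductive LocalState (C : Type u) [Field C] : Type u
  | start
  | loop (d₀ : ℕ) (k : ℤ)
  | returned (res : Option (DiffOp C))

/-- The steps of `QuasiSymmetricQuotientAtZero(M, L)`. Subroutines may return any result that
meets their specification. -/
inductive LocalStep (M L : DiffOp C) : LocalState C → LocalState C → Prop
  | dimZero (hδ : colonDim M L = 0) : LocalStep M L .start (.returned (some 1))
  | init (hδ : 0 < colonDim M L) (P N : DiffOp C) (z d₀ : ℕ)
      (hP : IsSymPower L (L.natDegree - 1) P) (hN : IsSymProduct M P N)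
      (hz : N.IsMaxIndicialRoot z) (hd₀ : IsCoeffDegreeBound M L (colonDim M L) d₀) :
      LocalStep M L .start
        (.loop d₀ ((z : ℤ) - (L.natDegree : ℤ) * (L.natDegree - 1) / 2 + 1))
  | giveUp (d₀ : ℕ) (k : ℤ) (h : LoopBodyResult M L d₀ k none)
      (hk : ((colonDim M L : ℤ) + 1) * (d₀ + 1) + colonDim M L ≤ k) :
      LocalStep M L (.loop d₀ k) (.returned none)
  | accept (d₀ : ℕ) (k : ℤ) (Q : DiffOp C) (h : LoopBodyResult M L d₀ k (some Q))
      (hQ : Q.natDegree = colonDim M L ∧ SymProductDivides L Q M) :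
      LocalStep M L (.loop d₀ k) (.returned (some Q))
  | doubleEmpty (d₀ : ℕ) (k : ℤ) (h : LoopBodyResult M L d₀ k none)
      (hk : ¬ ((colonDim M L : ℤ) + 1) * (d₀ + 1) + colonDim M L ≤ k) :
      LocalStep M L (.loop d₀ k) (.loop d₀ (2 * k))
  | doubleReject (d₀ : ℕ) (k : ℤ) (Q : DiffOp C) (h : LoopBodyResult M L d₀ k (some Q))
      (hQ : ¬ (Q.natDegree = colonDim M L ∧ SymProductDivides L Q M)) :
      LocalStep M L (.loop d₀ k) (.loop d₀ (2 * k))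

/-- The states of `QuasiSymmetricQuotient`: before the choice of the point, during the call of the
local algorithm after the shift by `ξ`, and after returning; `returned none` stands for *Fail*. -/
inductive State (C : Type u) [Field C] : Type u
  | start
  | running (ξ : C) (s : LocalState C)
  | returned (res : Option (DiffOp C))

/-- The steps of `QuasiSymmetricQuotient(M, L)`. -/
inductive Step (M L : DiffOp C) : State C → State C → Prop
  | choose (ξ : C) (hL : L.IsOrdinaryPoint ξ) (hM : M.IsOrdinaryPoint ξ) :
      Step M L .start (.running ξ .start)
  | localStep (ξ : C) (s t : LocalState C) (h : LocalStep (M.shift ξ) (L.shift ξ) s t) :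
      Step M L (.running ξ s) (.running ξ t)
  | fail (ξ : C) : Step M L (.running ξ (.returned none)) (.returned none)
  | finish (ξ : C) (Q : DiffOp C) :
      Step M L (.running ξ (.returned (some Q))) (.returned (some (Q.shift (-ξ))))

/-- The algorithm `QuasiSymmetricQuotient(M, L)` returns `Q`: whatever choices are made, there is
no infinite run, and every state reached either allows a further step or has returned `Q`. -/
def AlgorithmReturns (M L Q : DiffOp C) : Prop :=
  Acc (fun t s => Step M L s t) State.start ∧
    ∀ s, Relation.ReflTransGen (Step M L) State.start s →
      (∃ t, Step M L s t) ∨ s = State.returned (some Q)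

end SymDivision

end

noncomputable section

namespace DiffOp

variable {C : Type u} [Field C]

/-! ### Operators with constant coefficients -/

/-! An operator with constant coefficients is a polynomial in the derivation, so the problem reduces
to finite-dimensional spaces of Laurent series stable under derivation. By Cayley–Hamilton such a
space is V(w) for w the characteristic polynomial of the derivation on it
(`exists_solutionSpace_eq`). The colon space is stable because h'g = (hg)' - hg'. This gives a monic
q of degree δ with V(q) = (V(M) : V(L)), and the quotient is q(D).

The span of V(L)V(q) lies in V(M) and is the solution space of the symmetric product
(`exists_isSymProduct_map_C`). Annihilation in every differential extension comes from one identity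
in C[s]/(p) ⊗ C[t]/(q) (`aeval_root_tmul_eq_zero`). For maximality and uniqueness, a competitor P is
expanded at a point ξ where its leading coefficient, after clearing denominators, does not vanish.
Its ord(P) independent power series solutions there lie in the colon space, since L and M are
unchanged by x → x + ξ (`natDegree_le_finrank_colonSpace`).

For the algorithm three facts suffice. The initial precision k is at least 1, because orders of
series add under products (`one_le_precision`). Once k ≥ δ, the quotient is itself an approximant,
so `none` cannot occur (`isApproximantAnnihilator`). Once k > d₀ + δ, invertibility of the Wronskian
at 0 leaves no other approximant (`eq_of_isApproximantAnnihilator`). Repeated doubling reaches this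
range. -/

theorem ratFunc_C_deriv (c : C) : (RatFunc.C c : RatFunc C)′ = 0 := by
  change ratDeriv _ = 0
  simp [ratDeriv]

theorem laurentSeries_deriv_eq (f : C⸨X⸩) : f′ = LaurentSeries.derivative C f := rfl

theorem coeff_derivative_pow (i : ℕ) (f : C⸨X⸩) (m : ℤ) :
    ((LaurentSeries.derivative C ^ i) f).coeff m =
      (∏ j ∈ Finset.range i, ((m + 1 + j : ℤ) : C)) * f.coeff (m + i) := by
  induction i generalizing m with
  | zero => simp
  | succ i ih =>
    have h1 : ∀ g : C⸨X⸩, (LaurentSeries.derivative C g).coeff m =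
        ((m + 1 : ℤ) : C) * g.coeff (m + 1) := by
      intro g
      simp
    rw [pow_succ', Module.End.mul_apply, h1, ih, Finset.prod_range_succ', mul_comm _ (((m + 1 + _ : ℤ) : C)),
      mul_assoc]
    congr 2
    · simp
    · refine Finset.prod_congr rfl fun j _ => ?_
      push_cast
      ring
    · congr 1
      push_cast
      ring

/-- An operator with constant coefficients acts as a polynomial in the derivation. -/
theorem act_map_C {F : Type u} [CommRing F] [Differential F] [Algebra (RatFunc C) F]
    [Module C F] (hsmul : ∀ (c : C) (f : F), c • f = algebraMap (RatFunc C) F (RatFunc.C c) * f)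
    (D : Module.End C F) (hD : ∀ f : F, D f = f′)
    (p : C[X]) (f : F) : act (p.map RatFunc.C) f = aeval D p f := by
  have hpow : ∀ (n : ℕ), (fun g : F => g′)^[n] f = (D ^ n) f := by
    intro n
    rw [Module.End.pow_apply]
    congr 2
    ext g
    exact (hD g).symm
  induction p using Polynomial.induction_on' with
  | add p q hp hq => rw [Polynomial.map_add, act_add, hp, hq, map_add, LinearMap.add_apply]
  | monomial n a =>
    rw [map_monomial, act_monomial, hpow, aeval_monomial, Module.End.mul_apply,
      Module.algebraMap_end_apply, hsmul]

theorem algebraMap_polynomial_laurentSeries (p : C[X]) :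
    algebraMap (RatFunc C) C⸨X⸩ (algebraMap C[X] (RatFunc C) p) =
      HahnSeries.ofPowerSeries ℤ C (p : PowerSeries C) := by
  rw [← IsScalarTower.algebraMap_apply, Polynomial.algebraMap_hahnSeries_apply]

theorem algebraMap_ratFunc_C_laurentSeries (c : C) :
    algebraMap (RatFunc C) C⸨X⸩ (RatFunc.C c) = HahnSeries.C c := by
  rw [← RatFunc.algebraMap_C, algebraMap_polynomial_laurentSeries, Polynomial.coe_C,
    HahnSeries.ofPowerSeries_C]

theorem act_map_C_laurentSeries (p : C[X]) (f : C⸨X⸩) :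
    act (p.map RatFunc.C) f = aeval (LaurentSeries.derivative C) p f :=
  act_map_C (fun c f => by rw [algebraMap_ratFunc_C_laurentSeries, HahnSeries.C_mul_eq_smul])
    (LaurentSeries.derivative C) (fun _ => rfl) p f

theorem mem_solutionSpace {L : DiffOp C} {f : C⸨X⸩} : f ∈ L.solutionSpace ↔ L.act f = 0 := Iff.rfl

theorem mem_solutionSpace_map_C {p : C[X]} {f : C⸨X⸩} :
    f ∈ solutionSpace (p.map RatFunc.C) ↔ aeval (LaurentSeries.derivative C) p f = 0 := by
  rw [mem_solutionSpace, act_map_C_laurentSeries]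

theorem coeff_aeval_derivative (p : C[X]) (f : C⸨X⸩) (m : ℤ) :
    (aeval (LaurentSeries.derivative C) p f).coeff m = ∑ i ∈ Finset.range (p.natDegree + 1),
      p.coeff i * ((∏ j ∈ Finset.range i, ((m + 1 + j : ℤ) : C)) * f.coeff (m + i)) := by
  rw [aeval_eq_sum_range, LinearMap.sum_apply, HahnSeries.coeff_sum]
  refine Finset.sum_congr rfl fun i _ => ?_
  rw [LinearMap.smul_apply, HahnSeries.coeff_smul, coeff_derivative_pow, smul_eq_mul]

/-- The orders of the nonzero solutions are bounded by the order of the operator. -/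
theorem order_mem_Ico_of_mem_solutionSpace [CharZero C] {p : C[X]} (hp : p ≠ 0) {f : C⸨X⸩}
    (hf : f ∈ solutionSpace (p.map RatFunc.C)) (h0 : f ≠ 0) :
    f.order ∈ Set.Ico (0 : ℤ) p.natDegree := by
  by_contra hv
  rw [mem_solutionSpace_map_C] at hf
  -- With v the order of f and n that of the operator, only the term of `D ^ n` reaches x^(v-n). It
  -- contributes v(v-1)⋯(v-n+1) times nonzero factors, so v is one of 0, …, n-1.
  have h1 := congrArg (fun g : C⸨X⸩ => g.coeff (f.order - p.natDegree)) hf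
  simp only [coeff_aeval_derivative, HahnSeries.coeff_zero] at h1
  rw [Finset.sum_range_succ, Finset.sum_eq_zero, zero_add] at h1
  · rw [sub_add_cancel] at h1
    have h2 : f.coeff f.order ≠ 0 := HahnSeries.coeff_order_eq_zero.not.mpr h0
    have h3 : p.coeff p.natDegree ≠ 0 := leadingCoeff_ne_zero.mpr hp
    refine mul_ne_zero h3 (mul_ne_zero (Finset.prod_ne_zero_iff.mpr fun j hj => ?_) h2) h1
    rw [Finset.mem_range] at hj
    rw [Int.cast_ne_zero]
    intro h4
    apply hv
    constructor <;> omega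
  · intro i hi
    rw [Finset.mem_range] at hi
    rw [HahnSeries.coeff_eq_zero_of_lt_order, mul_zero, mul_zero]
    omega

/-- A solution is determined by its initial coefficients. -/
theorem eq_zero_of_coeff_eq_zero [CharZero C] {p : C[X]} (hp : p ≠ 0) {f : C⸨X⸩}
    (hf : f ∈ solutionSpace (p.map RatFunc.C)) (h : ∀ i : Fin p.natDegree, f.coeff (i : ℕ) = 0) :
    f = 0 := by
  by_contra h0
  obtain ⟨h1, h2⟩ := order_mem_Ico_of_mem_solutionSpace hp hf h0
  have h3 := h ⟨f.order.toNat, by omega⟩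
  simp only [Int.toNat_of_nonneg h1] at h3
  exact h0 (HahnSeries.coeff_order_eq_zero.mp h3)

/-- The initial coefficients of a solution. -/
def initialCoeffs (p : C[X]) :
    solutionSpace (p.map RatFunc.C) →ₗ[C] (Fin p.natDegree → C) where
  toFun f i := (f : C⸨X⸩).coeff (i : ℕ)
  map_add' _ _ := rfl
  map_smul' _ _ := rfl

theorem initialCoeffs_injective [CharZero C] {p : C[X]} (hp : p ≠ 0) :
    Function.Injective (initialCoeffs p) := by
  rw [injective_iff_map_eq_zero]
  intro f hf
  exact Subtype.ext (eq_zero_of_coeff_eq_zero hp f.2 fun i => congrFun hf i)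

theorem finite_solutionSpace [CharZero C] {p : C[X]} (hp : p ≠ 0) :
    Module.Finite C (solutionSpace (p.map RatFunc.C)) :=
  Module.Finite.of_injective _ (initialCoeffs_injective hp)

theorem finrank_solutionSpace_le [CharZero C] {p : C[X]} (hp : p ≠ 0) :
    Module.finrank C (solutionSpace (p.map RatFunc.C)) ≤ p.natDegree := by
  simpa using LinearMap.finrank_le_finrank_of_injective (initialCoeffs_injective hp)

/-- A finite-dimensional space of Laurent series that is closed under derivation is the solution
space of an operator with constant coefficients. -/
theorem exists_solutionSpace_eq [CharZero C] (W : Submodule C C⸨X⸩) [Module.Finite C W]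
    (hW : ∀ f ∈ W, f′ ∈ W) :
    ∃ w : C[X], w.Monic ∧ w.natDegree = Module.finrank C W ∧
      solutionSpace (w.map RatFunc.C) = W := by
  set d : Module.End C W := (LaurentSeries.derivative C).restrict hW with hd
  have hmon := d.charpoly_monic
  have hle : W ≤ solutionSpace (d.charpoly.map RatFunc.C) := by
    intro f hf
    have h1 : ∀ (p : C[X]) (g : W),
        aeval (LaurentSeries.derivative C) p (g : C⸨X⸩) = (aeval d p g : W) := by
      intro p
      induction p using Polynomial.induction_on' with
      | add p q hp hq => intro g; simp [hp, hq]
      | monomial n a =>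
        intro g
        simp only [aeval_monomial, Module.End.mul_apply, Module.algebraMap_end_apply,
          Submodule.coe_smul]
        congr 1
        induction n with
        | zero => rfl
        | succ n ih => rw [pow_succ', pow_succ', Module.End.mul_apply, Module.End.mul_apply, ih]; rfl
    rw [mem_solutionSpace_map_C, h1 _ ⟨f, hf⟩, LinearMap.aeval_self_charpoly]
    rfl
  have := finite_solutionSpace hmon.ne_zero
  refine ⟨d.charpoly, hmon, d.charpoly_natDegree, ?_⟩
  -- The dimension of V(w) is at most deg w, which is the dimension of W for a characteristic
  -- polynomial.
  refine (Submodule.eq_of_le_of_finrank_le hle ?_).symm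
  rw [← d.charpoly_natDegree]
  exact finrank_solutionSpace_le hmon.ne_zero

/-! ### Power series solutions at ordinary points -/

/-- Strong recursion in which the earlier values are extended by zero, so that the rule can be
stated for a whole power series. -/
theorem exists_seq_of_rec {R : Type*} [Zero R] (F : ℕ → (ℕ → R) → R) :
    ∃ c : ℕ → R, ∀ n, c n = F n fun m => if m < n then c m else 0 := by
  refine ⟨fun n => Nat.strongRec (motive := fun _ => R)
    (fun n g => F n fun m => if h : m < n then g m h else 0) n, fun n => ?_⟩
  dsimp only
  rw [Nat.strongRec_eq]
  congr 1

theorem coeff_powerSeries_derivative_iterate (i : ℕ) (f : PowerSeries C) (n : ℕ) :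
    PowerSeries.coeff n ((PowerSeries.derivative C)^[i] f) =
      (∏ j ∈ Finset.range i, ((n + 1 + j : ℕ) : C)) * PowerSeries.coeff (n + i) f := by
  induction i generalizing n with
  | zero => simp
  | succ i ih =>
    rw [Function.iterate_succ_apply', PowerSeries.coeff_derivative, ih, Finset.prod_range_succ',
      mul_comm, ← mul_assoc, mul_comm (∏ _ ∈ _, _), add_right_comm n 1 i, add_assoc n i 1]
    congr 2
    · simp
    · refine Finset.prod_congr rfl fun j _ => ?_
      push_cast
      ring

/-- The initial value problem for a monic operator with power series coefficients is solvable. -/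
theorem exists_powerSeries_solution [CharZero C] (p : ℕ) (a : ℕ → PowerSeries C) (c : ℕ → C) :
    ∃ f : PowerSeries C, (∀ i < p, PowerSeries.coeff i f = c i) ∧
      (PowerSeries.derivative C)^[p] f =
        ∑ i ∈ Finset.range p, a i * (PowerSeries.derivative C)^[i] f := by
  have hne : ∀ n : ℕ, (∏ j ∈ Finset.range p, ((n + 1 + j : ℕ) : C)) ≠ 0 := fun n =>
    Finset.prod_ne_zero_iff.mpr fun j _ => Nat.cast_ne_zero.mpr (by omega)
  obtain ⟨s, hs⟩ := exists_seq_of_rec (R := C) fun n g =>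
    if n < p then c n else (∏ j ∈ Finset.range p, ((n - p + 1 + j : ℕ) : C))⁻¹ *
      PowerSeries.coeff (n - p)
        (∑ i ∈ Finset.range p, a i * (PowerSeries.derivative C)^[i] (PowerSeries.mk g))
  refine ⟨PowerSeries.mk s, fun i hi => ?_, ?_⟩
  · rw [PowerSeries.coeff_mk, hs, if_pos hi]
  · ext n
    rw [coeff_powerSeries_derivative_iterate, PowerSeries.coeff_mk, hs (n + p),
      if_neg (by omega), Nat.add_sub_cancel, mul_inv_cancel_left₀ (hne n), map_sum, map_sum]
    refine Finset.sum_congr rfl fun i hi => ?_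
    rw [Finset.mem_range] at hi
    rw [PowerSeries.coeff_mul, PowerSeries.coeff_mul]
    refine Finset.sum_congr rfl fun kl hkl => ?_
    rw [Finset.HasAntidiagonal.mem_antidiagonal] at hkl
    -- The right side has order below p, so its n-th coefficient uses only coefficients of f below n
    -- + p; cutting the sequence off there changes nothing.
    rw [coeff_powerSeries_derivative_iterate, coeff_powerSeries_derivative_iterate,
      PowerSeries.coeff_mk, PowerSeries.coeff_mk, if_pos (by omega)]

theorem deriv_ofPowerSeries (f : PowerSeries C) :
    (HahnSeries.ofPowerSeries ℤ C f)′ =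
      HahnSeries.ofPowerSeries ℤ C (PowerSeries.derivative C f) := by
  rw [laurentSeries_deriv_eq]
  ext n
  have h : (LaurentSeries.derivative C (HahnSeries.ofPowerSeries ℤ C f)).coeff n =
      ((n + 1 : ℤ) : C) * (HahnSeries.ofPowerSeries ℤ C f).coeff (n + 1) := by
    simp
  rw [h]
  rcases lt_trichotomy n (-1) with hn | rfl | hn
  · rw [PowerSeries.coeff_coe, PowerSeries.coeff_coe, if_pos (by omega), if_pos (by omega), mul_zero]
  · simp [PowerSeries.coeff_coe]
  · obtain ⟨k, rfl⟩ := Int.eq_ofNat_of_zero_le (show 0 ≤ n by omega)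
    rw [PowerSeries.coeff_coe, PowerSeries.coeff_coe, if_neg (by omega), if_neg (by omega),
      PowerSeries.coeff_derivative, mul_comm]
    have h1 : ((k : ℤ) + 1).natAbs = k + 1 := by omega
    simp [h1]

theorem iterate_deriv_ofPowerSeries (n : ℕ) (f : PowerSeries C) :
    (fun g : C⸨X⸩ => g′)^[n] (HahnSeries.ofPowerSeries ℤ C f) =
      HahnSeries.ofPowerSeries ℤ C ((PowerSeries.derivative C)^[n] f) := by
  induction n with
  | zero => rfl
  | succ n ih =>
    rw [Function.iterate_succ_apply', Function.iterate_succ_apply', ih, deriv_ofPowerSeries]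

theorem act_eq_sum_range {F : Type u} [CommRing F] [Differential F] [Algebra (RatFunc C) F]
    (L : DiffOp C) {n : ℕ} (hn : L.natDegree < n) (f : F) :
    L.act f = ∑ i ∈ Finset.range n,
      algebraMap (RatFunc C) F (L.coeff i) * (fun g : F => g′)^[i] f :=
  Polynomial.sum_over_range' _ (fun _ => by simp) _ hn

theorem act_C_mul {F : Type u} [CommRing F] [Differential F] [Algebra (RatFunc C) F]
    (a : RatFunc C) (L : DiffOp C) (f : F) :
    act (Polynomial.C a * L) f = algebraMap (RatFunc C) F a * L.act f := by
  induction L using Polynomial.induction_on' with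
  | add A B hA hB => rw [mul_add, act_add, act_add, hA, hB, mul_add]
  | monomial n b => rw [C_mul_monomial, act_monomial, act_monomial, map_mul, mul_assoc]

theorem act_map_algebraMap_ofPowerSeries (q : C[X][X]) {n : ℕ} (hn : q.natDegree < n)
    (f : PowerSeries C) :
    act (q.map (algebraMap C[X] (RatFunc C))) (HahnSeries.ofPowerSeries ℤ C f) =
      HahnSeries.ofPowerSeries ℤ C (∑ i ∈ Finset.range n,
        (q.coeff i : PowerSeries C) * (PowerSeries.derivative C)^[i] f) := by
  rw [act_eq_sum_range _ (natDegree_map_le.trans_lt hn), map_sum]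
  refine Finset.sum_congr rfl fun i _ => ?_
  rw [coeff_map, algebraMap_polynomial_laurentSeries, iterate_deriv_ofPowerSeries, map_mul]

theorem map_C_map_algebraMap (p : C[X]) :
    (p.map Polynomial.C).map (algebraMap C[X] (RatFunc C)) = p.map RatFunc.C := by
  rw [Polynomial.map_map]
  congr 1

/-- The initial coefficients `0, …, 0, 1, 0, …, 0`. -/
def IsFundamentalSystem {n : ℕ} (f : Fin n → PowerSeries C) : Prop :=
  ∀ i j : Fin n, PowerSeries.coeff i (f j) = if i = j then 1 else 0

theorem exists_fundamentalSystem [CharZero C] (q : C[X][X]) (hq : q.leadingCoeff.eval 0 ≠ 0) :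
    ∃ f : Fin q.natDegree → PowerSeries C, IsFundamentalSystem f ∧
      ∀ j, HahnSeries.ofPowerSeries ℤ C (f j) ∈
        solutionSpace (q.map (algebraMap C[X] (RatFunc C))) := by
  have hu : (q.leadingCoeff : PowerSeries C) * (q.leadingCoeff : PowerSeries C)⁻¹ = 1 := by
    refine PowerSeries.mul_inv_cancel _ ?_
    rwa [← PowerSeries.coeff_zero_eq_constantCoeff_apply, Polynomial.coeff_coe,
      Polynomial.coeff_zero_eq_eval_zero]
  choose f hf1 hf2 using fun j : Fin q.natDegree =>
    exists_powerSeries_solution q.natDegree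
      (fun i => -(q.leadingCoeff : PowerSeries C)⁻¹ * (q.coeff i : PowerSeries C))
      (fun i => if i = j then 1 else 0)
  refine ⟨f, fun i j => ?_, fun j => ?_⟩
  · rw [hf1 j i i.2]
    simp only [Fin.ext_iff]
  · rw [mem_solutionSpace, act_map_algebraMap_ofPowerSeries q (Nat.lt_succ_self _),
      Finset.sum_range_succ, hf2 j, coeff_natDegree, Finset.mul_sum, ← Finset.sum_add_distrib,
      Finset.sum_eq_zero, map_zero]
    intro i _
    linear_combination (-(q.coeff i : PowerSeries C) * (PowerSeries.derivative C)^[i] (f j)) * hu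

theorem exists_fundamentalSystem_map_C [CharZero C] {p : C[X]} (hp : p ≠ 0) :
    ∃ f : Fin p.natDegree → PowerSeries C, IsFundamentalSystem f ∧
      ∀ j, HahnSeries.ofPowerSeries ℤ C (f j) ∈ solutionSpace (p.map RatFunc.C) := by
  have h := exists_fundamentalSystem (p.map Polynomial.C) (by
    rw [leadingCoeff_map, eval_C]
    exact leadingCoeff_ne_zero.mpr hp)
  rwa [map_C_map_algebraMap, natDegree_map] at h

theorem IsFundamentalSystem.constantCoeff_iterate [CharZero C] {n : ℕ} {f : Fin n → PowerSeries C}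
    (hf : IsFundamentalSystem f) (i j : Fin n) :
    PowerSeries.coeff 0 ((PowerSeries.derivative C)^[i] (f j)) =
      if i = j then ∏ l ∈ Finset.range i, ((0 + 1 + l : ℕ) : C) else 0 := by
  rw [coeff_powerSeries_derivative_iterate, zero_add (i : ℕ), hf i j]
  split_ifs <;> simp

/-- The Wronskian of a fundamental system is invertible. -/
theorem IsFundamentalSystem.X_pow_dvd [CharZero C] {n : ℕ} {f : Fin n → PowerSeries C}
    (hf : IsFundamentalSystem f) (r : ℕ → PowerSeries C) (m : ℕ)
    (h : ∀ j, PowerSeries.X ^ m ∣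
      ∑ i ∈ Finset.range n, r i * (PowerSeries.derivative C)^[i] (f j)) :
    ∀ i < n, PowerSeries.X ^ m ∣ r i := by
  set A : Matrix (Fin n) (Fin n) (PowerSeries C) :=
    Matrix.of fun j i => (PowerSeries.derivative C)^[i] (f j) with hA
  have hdet : IsUnit A.det := by
    rw [PowerSeries.isUnit_iff_constantCoeff, RingHom.map_det]
    -- At x = 0 the Wronskian matrix is diagonal with entries i!, nonzero in characteristic zero.
    have h1 : (PowerSeries.constantCoeff (R := C)).mapMatrix A =
        Matrix.diagonal fun i : Fin n => ∏ l ∈ Finset.range i, ((0 + 1 + l : ℕ) : C) := by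
      ext j i
      rw [RingHom.mapMatrix_apply, Matrix.map_apply, hA, Matrix.of_apply,
        ← PowerSeries.coeff_zero_eq_constantCoeff_apply, hf.constantCoeff_iterate,
        Matrix.diagonal_apply]
      by_cases hij : i = j
      · simp [hij]
      · rw [if_neg hij, if_neg (Ne.symm hij)]
    rw [h1, Matrix.det_diagonal, isUnit_iff_ne_zero]
    exact Finset.prod_ne_zero_iff.mpr fun i _ => Finset.prod_ne_zero_iff.mpr fun l _ =>
      Nat.cast_ne_zero.mpr (by omega)
  intro i hi
  set v : Fin n → PowerSeries C := fun i => r i with hv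
  have h2 : A.adjugate.mulVec (A.mulVec v) = A.det • v := by
    rw [Matrix.mulVec_mulVec, Matrix.adjugate_mul, Matrix.smul_mulVec, Matrix.one_mulVec]
  have h3 := congrFun h2 ⟨i, hi⟩
  have h4 : PowerSeries.X ^ m ∣ A.det * r i := by
    rw [Pi.smul_apply, smul_eq_mul] at h3
    rw [show r i = v ⟨i, hi⟩ from rfl, ← h3]
    change PowerSeries.X ^ m ∣ ∑ j : Fin n, A.adjugate ⟨i, hi⟩ j * A.mulVec v j
    refine Finset.dvd_sum fun j _ => Dvd.dvd.mul_left ?_ _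
    have h5 := h j
    rw [Finset.sum_range] at h5
    have h6 : A.mulVec v j = ∑ l : Fin n, r l * (PowerSeries.derivative C)^[l] (f j) := by
      rw [Matrix.mulVec_eq_sum, Finset.sum_apply]
      refine Finset.sum_congr rfl fun l _ => ?_
      rw [Pi.smul_apply, Matrix.transpose_apply, hA, Matrix.of_apply, op_smul_eq_mul,
        mul_comm]
    rwa [h6]
  exact (hdet.dvd_mul_left).mp h4

/-- An operator of order at most `n` with polynomial coefficients that nearly annihilates the
solutions of a monic operator `w` of order `n` with constant coefficients is a multiple of `w`. -/
theorem eq_C_mul_of_coeff_act_eq_zero [CharZero C] {w : C[X]} (hw : w.Monic) {q : C[X][X]}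
    (hq : q.natDegree ≤ w.natDegree) {d m : ℕ} (hd : ∀ i, (q.coeff i).natDegree ≤ d) (hdm : d < m)
    (h : ∀ f ∈ solutionSpace (w.map RatFunc.C), ∀ i : ℤ, i < m →
      (act (q.map (algebraMap C[X] (RatFunc C))) f).coeff i = 0) :
    q = Polynomial.C (q.coeff w.natDegree) * w.map Polynomial.C := by
  have hex := exists_fundamentalSystem_map_C hw.ne_zero
  set n := w.natDegree with hn
  obtain ⟨f, hf, hfw⟩ := hex
  have hwc : ∀ j, ∑ i ∈ Finset.range (n + 1),
      (((w.map Polynomial.C).coeff i : C[X]) : PowerSeries C) *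
        (PowerSeries.derivative C)^[i] (f j) = 0 := by
    intro j
    have h1 := hfw j
    rw [mem_solutionSpace, ← map_C_map_algebraMap, act_map_algebraMap_ofPowerSeries (n := n + 1) _
      (by rw [natDegree_map]; omega)] at h1
    refine HahnSeries.ofPowerSeries_injective (Γ := ℤ) (R := C) ?_
    rw [map_zero]
    exact h1
  -- Subtracting this multiple of w removes the coefficient of `D ^ n` without changing the action
  -- on V(w), so the Wronskian argument applies to the remainder.
  set R := q - Polynomial.C (q.coeff n) * w.map Polynomial.C with hR
  have hRn : R.coeff n = 0 := by
    rw [hR, coeff_sub, coeff_C_mul, coeff_map, hn, hw.coeff_natDegree]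
    simp
  have hdvd : ∀ j, PowerSeries.X ^ m ∣ ∑ i ∈ Finset.range n, (R.coeff i : PowerSeries C) *
      (PowerSeries.derivative C)^[i] (f j) := by
    intro j
    have h1 : ∑ i ∈ Finset.range n, (R.coeff i : PowerSeries C) *
        (PowerSeries.derivative C)^[i] (f j) = ∑ i ∈ Finset.range (n + 1),
          (q.coeff i : PowerSeries C) * (PowerSeries.derivative C)^[i] (f j) := by
      have h2 : ∑ i ∈ Finset.range (n + 1), (R.coeff i : PowerSeries C) *
          (PowerSeries.derivative C)^[i] (f j) = ∑ i ∈ Finset.range (n + 1),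
          (q.coeff i : PowerSeries C) * (PowerSeries.derivative C)^[i] (f j) := by
        rw [← sub_zero (∑ i ∈ _, (q.coeff i : PowerSeries C) * _),
          ← mul_zero (q.coeff n : PowerSeries C), ← hwc j, Finset.mul_sum, ← Finset.sum_sub_distrib]
        refine Finset.sum_congr rfl fun i _ => ?_
        rw [hR, coeff_sub, coeff_C_mul, Polynomial.coe_sub, Polynomial.coe_mul]
        ring
      rw [← h2, Finset.sum_range_succ, hRn, Polynomial.coe_zero, zero_mul, add_zero]
    rw [h1, PowerSeries.X_pow_dvd_iff]
    intro i hi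
    have h3 := h _ (hfw j) i (by exact_mod_cast hi)
    rw [act_map_algebraMap_ofPowerSeries (n := n + 1) _ (by omega)] at h3
    rwa [HahnSeries.ofPowerSeries_apply_coeff] at h3
  have hzero := hf.X_pow_dvd (fun i => (R.coeff i : PowerSeries C)) m hdvd
  rw [← sub_eq_zero, ← hR]
  ext1 i
  rw [coeff_zero]
  rcases lt_or_ge i n with hi | hi
  · have h1 := hzero i hi
    rw [PowerSeries.X_pow_dvd_iff] at h1
    ext1 l
    rw [coeff_zero]
    by_cases hl : l < m
    · have h2 := h1 l hl
      rwa [Polynomial.coeff_coe] at h2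
    -- Each coefficient of the remainder is divisible by X^m and has degree at most d < m, as w has
    -- constant coefficients; hence it is zero.
    · refine coeff_eq_zero_of_natDegree_lt (lt_of_le_of_lt ?_ (not_lt.mp hl |>.trans_lt' hdm))
      rw [hR, coeff_sub, coeff_C_mul, coeff_map]
      refine (natDegree_sub_le _ _).trans (max_le (hd i) ?_)
      refine (natDegree_mul_C_le _ _).trans (hd n)
  · rcases hi.eq_or_lt with rfl | hi
    · exact hRn
    · rw [hR, coeff_sub, coeff_C_mul, coeff_map, coeff_eq_zero_of_natDegree_lt (hq.trans_lt hi),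
        coeff_eq_zero_of_natDegree_lt hi]
      simp

theorem exists_C_mul_eq_map (P : DiffOp C) : ∃ c : C[X], c ≠ 0 ∧ ∃ q : C[X][X],
    q.natDegree = P.natDegree ∧ q.map (algebraMap C[X] (RatFunc C)) =
      Polynomial.C (algebraMap C[X] (RatFunc C) c) * P := by
  obtain ⟨b, hbm, hb⟩ := IsLocalization.integerNormalization_spec (nonZeroDivisors C[X]) P
  have hb0 : b ≠ 0 := nonZeroDivisors.ne_zero hbm
  have h1 : (IsLocalization.integerNormalization (nonZeroDivisors C[X]) P).map
      (algebraMap C[X] (RatFunc C)) = Polynomial.C (algebraMap C[X] (RatFunc C) b) * P := by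
    rw [hb, Polynomial.C_mul']
    ext i
    rw [coeff_smul, coeff_smul, Algebra.smul_def, smul_eq_mul]
  refine ⟨b, hb0, _, ?_, h1⟩
  rw [← natDegree_map_eq_of_injective (RatFunc.algebraMap_injective C), h1,
    natDegree_C_mul (RatFunc.algebraMap_ne_zero hb0)]

/-- An operator of order at most `n` that annihilates the solutions of a monic operator `w` of
order `n` with constant coefficients is a multiple of `w`. -/
theorem eq_C_mul_of_act_eq_zero [CharZero C] {w : C[X]} (hw : w.Monic) {P : DiffOp C}
    (hP : P.natDegree ≤ w.natDegree)
    (h : ∀ f ∈ solutionSpace (w.map RatFunc.C), P.act f = 0) :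
    P = Polynomial.C (P.coeff w.natDegree) * w.map RatFunc.C := by
  obtain ⟨c, hc, q, hqd, hq⟩ := exists_C_mul_eq_map P
  have h1 := eq_C_mul_of_coeff_act_eq_zero hw (q := q) (hqd.trans_le hP)
    -- Annihilation is exact, so any precision is available; the sum of all degrees is a crude
    -- degree bound.
    (d := ∑ i ∈ Finset.range (q.natDegree + 1), (q.coeff i).natDegree)
    (m := ∑ i ∈ Finset.range (q.natDegree + 1), (q.coeff i).natDegree + 1) (fun i => by
      by_cases hi : i ∈ Finset.range (q.natDegree + 1)
      · exact Finset.single_le_sum (f := fun i => (q.coeff i).natDegree) (fun _ _ => Nat.zero_le _) hi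
      · rw [Finset.mem_range, not_lt] at hi
        rw [coeff_eq_zero_of_natDegree_lt (by omega), natDegree_zero]
        exact Nat.zero_le _) (Nat.lt_succ_self _) (fun f hf i _ => by
      rw [hq, act_C_mul, h f hf, mul_zero, HahnSeries.coeff_zero])
  have h2 := congrArg (Polynomial.map (algebraMap C[X] (RatFunc C))) h1
  rw [Polynomial.map_mul, map_C, map_C_map_algebraMap, ← coeff_map, hq, coeff_C_mul, C_mul,
    mul_assoc] at h2
  exact mul_left_cancel₀ (C_ne_zero.mpr (RatFunc.algebraMap_ne_zero hc)) h2

/-- An operator of smaller order would be a multiple of w whose factor, its coefficient at the order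
of w, is zero. -/
theorem natDegree_ge_of_act_eq_zero [CharZero C] {w : C[X]} (hw : w.Monic) {P : DiffOp C}
    (hP : P ≠ 0) (h : ∀ f ∈ solutionSpace (w.map RatFunc.C), P.act f = 0) :
    w.natDegree ≤ P.natDegree := by
  by_contra hlt
  rw [not_le] at hlt
  apply hP
  rw [eq_C_mul_of_act_eq_zero hw hlt.le h, coeff_eq_zero_of_natDegree_lt hlt, C_0, zero_mul]

/-! ### Primitive operators and constant coefficients -/

theorem isPrimitiveOp_map_C {w : C[X]} (hw : w.Monic) : IsPrimitiveOp (w.map RatFunc.C) := by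
  refine ⟨w.map Polynomial.C, (hw.map _).isPrimitive, ?_, (map_C_map_algebraMap w).symm⟩
  rw [leadingCoeff_map, hw.leadingCoeff, C_1]
  exact monic_one

theorem IsPrimitiveOp.ne_zero {P : DiffOp C} (hP : P.IsPrimitiveOp) : P ≠ 0 := by
  obtain ⟨q, hq, -, rfl⟩ := hP
  exact (Polynomial.map_ne_zero_iff (RatFunc.algebraMap_injective C)).mpr hq.ne_zero

/-- A primitive operator that is a multiple of a monic operator with constant coefficients
is equal to it. -/
theorem IsPrimitiveOp.eq_map_C {P : DiffOp C} (hP : P.IsPrimitiveOp) {w : C[X]} (hw : w.Monic)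
    {a : RatFunc C} (h : P = Polynomial.C a * w.map RatFunc.C) : P = w.map RatFunc.C := by
  obtain ⟨q, hq, hq1, rfl⟩ := hP
  have hinj := RatFunc.algebraMap_injective C
  have ha : algebraMap C[X] (RatFunc C) q.leadingCoeff = a := by
    rw [← leadingCoeff_map_of_injective hinj, h, leadingCoeff_mul, leadingCoeff_C, leadingCoeff_map,
      hw.leadingCoeff, map_one, mul_one]
  have h1 : q = Polynomial.C q.leadingCoeff * w.map Polynomial.C := by
    apply Polynomial.map_injective _ hinj
    rw [Polynomial.map_mul, map_C, map_C_map_algebraMap, ha]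
    exact h
  -- The leading coefficient divides every coefficient of q, so primitivity makes it a unit, and a
  -- monic unit is 1.
  have h2 : q.leadingCoeff = 1 := hq1.eq_one_of_isUnit (hq _ (Dvd.intro _ h1.symm))
  rw [h, ← ha, h2, map_one, C_1, one_mul]

/-! ### Symmetric products of operators with constant coefficients -/

/-- The class of 1 in C[X]/(p) is a universal solution of p, with multiplication by the root as
derivation; every solution is its image. -/
theorem exists_adjoinRoot_map {F : Type u} [AddCommGroup F] [Module C F] (D : Module.End C F)
    {p : C[X]} {f : F} (hf : aeval D p f = 0) :
    ∃ φ : AdjoinRoot p →ₗ[C] F, ∀ P : C[X], φ (AdjoinRoot.mk p P) = aeval D P f := by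
  set Φ : C[X] →ₗ[C] F := (LinearMap.applyₗ f).comp (aeval D).toLinearMap with hΦ
  have hle : (Ideal.span {p}).restrictScalars C ≤ LinearMap.ker Φ := by
    intro P hP
    obtain ⟨R, rfl⟩ := Ideal.mem_span_singleton'.mp ((Submodule.restrictScalars_mem C _ _).mp hP)
    rw [LinearMap.mem_ker]
    change aeval D (R * p) f = 0
    rw [map_mul, Module.End.mul_apply, hf, map_zero]
  exact ⟨(Submodule.liftQ _ Φ hle).comp
    (Submodule.Quotient.restrictScalarsEquiv C (Ideal.span {p})).symm.toLinearMap, fun P => rfl⟩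

open TensorProduct in
/-- The products of the derivatives of two solutions. -/
theorem exists_tensor_map {F : Type u} [CommRing F] [Differential F] [Algebra (RatFunc C) F]
    [Module C F] (hsmul : ∀ (c : C) (f : F), c • f = algebraMap (RatFunc C) F (RatFunc.C c) * f)
    (D : Module.End C F) (hD : ∀ f : F, D f = f′) {p q : C[X]} {f g : F}
    (hf : aeval D p f = 0) (hg : aeval D q g = 0) :
    ∃ Φ : AdjoinRoot p ⊗[C] AdjoinRoot q →ₗ[C] F,
      (∀ P Q : C[X], Φ (AdjoinRoot.mk p P ⊗ₜ AdjoinRoot.mk q Q) = aeval D P f * aeval D Q g) ∧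
      ∀ w : C[X], Φ (aeval (AdjoinRoot.root p ⊗ₜ[C] (1 : AdjoinRoot q) +
        (1 : AdjoinRoot p) ⊗ₜ[C] AdjoinRoot.root q) w) = aeval D w (f * g) := by
  obtain ⟨φ, hφ⟩ := exists_adjoinRoot_map D hf
  obtain ⟨ψ, hψ⟩ := exists_adjoinRoot_map D hg
  set Φ : AdjoinRoot p ⊗[C] AdjoinRoot q →ₗ[C] F := TensorProduct.lift
    (LinearMap.mk₂ C (fun a b => φ a * ψ b) (fun a b c => by rw [map_add, add_mul])
      (fun c a b => by rw [map_smul, hsmul, hsmul, mul_assoc])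
      (fun a b c => by rw [map_add, mul_add])
      (fun c a b => by rw [map_smul, hsmul, hsmul, mul_left_comm])) with hΦ
  have hΦ1 : ∀ P Q : C[X], Φ (AdjoinRoot.mk p P ⊗ₜ AdjoinRoot.mk q Q) =
      aeval D P f * aeval D Q g := by
    intro P Q
    rw [hΦ, TensorProduct.lift.tmul, LinearMap.mk₂_apply, hφ, hψ]
  set t : AdjoinRoot p ⊗[C] AdjoinRoot q := AdjoinRoot.root p ⊗ₜ[C] (1 : AdjoinRoot q) +
        (1 : AdjoinRoot p) ⊗ₜ[C] AdjoinRoot.root q with ht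
  -- This is the Leibniz rule: multiplication by t differentiates one factor at a time.
  have hΦ2 : ∀ u, Φ (t * u) = D (Φ u) := by
    intro u
    induction u using TensorProduct.induction_on with
    | zero => simp
    | add x y hx hy => rw [mul_add, map_add, hx, hy, map_add, map_add]
    | tmul a b =>
      obtain ⟨P, rfl⟩ := AdjoinRoot.mk_surjective a
      obtain ⟨Q, rfl⟩ := AdjoinRoot.mk_surjective b
      rw [ht, add_mul, Algebra.TensorProduct.tmul_mul_tmul, Algebra.TensorProduct.tmul_mul_tmul,
        one_mul, one_mul, ← AdjoinRoot.mk_X, ← AdjoinRoot.mk_X, ← map_mul, ← map_mul, map_add,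
        hΦ1, hΦ1, hΦ1, hD, Derivation.leibniz, map_mul, map_mul, aeval_X, Module.End.mul_apply,
        Module.End.mul_apply, hD, hD, smul_eq_mul, smul_eq_mul, mul_comm, add_comm]
  refine ⟨Φ, hΦ1, fun w => ?_⟩
  have hΦ3 : ∀ u, Φ (aeval t w * u) = aeval D w (Φ u) := by
    induction w using Polynomial.induction_on' with
    | add v w hv hw =>
      intro u
      rw [map_add, add_mul, map_add, hv, hw, map_add, LinearMap.add_apply]
    | monomial n a =>
      intro u
      rw [aeval_monomial, aeval_monomial, mul_assoc, ← Algebra.smul_def, map_smul,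
        Module.End.mul_apply, Module.algebraMap_end_apply]
      congr 1
      induction n with
      | zero => simp
      | succ n ih => rw [pow_succ', pow_succ', mul_assoc, hΦ2, ih, Module.End.mul_apply]
  have h1 := hΦ3 (1 ⊗ₜ 1)
  rw [← Algebra.TensorProduct.one_def, mul_one, Algebra.TensorProduct.one_def,
    ← map_one (AdjoinRoot.mk p), ← map_one (AdjoinRoot.mk q), hΦ1] at h1
  simpa using h1

theorem exists_basis_adjoinRoot {p : C[X]} (hp : p ≠ 0) :
    ∃ b : Module.Basis (Fin p.natDegree) C (AdjoinRoot p),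
      ∀ i, b i = AdjoinRoot.mk p (X ^ (i : ℕ)) := by
  refine ⟨(AdjoinRoot.powerBasis hp).basis, fun i => ?_⟩
  rw [map_pow, AdjoinRoot.mk_X]
  exact (AdjoinRoot.powerBasis hp).basis_eq_pow i

/-- Up to the factors k! l!, these constant terms are dual to the monomial basis of the tensor
product, so they read off coordinates there. -/
theorem coeff_aeval_X_pow_mul [CharZero C] {n m : ℕ} {f : Fin n → PowerSeries C}
    {g : Fin m → PowerSeries C} (hf : IsFundamentalSystem f) (hg : IsFundamentalSystem g)
    (k i : Fin n) (l j : Fin m) :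
    (aeval (LaurentSeries.derivative C) (X ^ (k : ℕ) : C[X]) (HahnSeries.ofPowerSeries ℤ C (f i)) *
      aeval (LaurentSeries.derivative C) (X ^ (l : ℕ) : C[X])
        (HahnSeries.ofPowerSeries ℤ C (g j))).coeff ((0 : ℕ) : ℤ) =
      (if k = i then ∏ a ∈ Finset.range k, ((0 + 1 + a : ℕ) : C) else 0) *
        (if l = j then ∏ a ∈ Finset.range l, ((0 + 1 + a : ℕ) : C) else 0) := by
  have h3 : ∀ (k : ℕ) (s : PowerSeries C),
      aeval (LaurentSeries.derivative C) (X ^ k : C[X]) (HahnSeries.ofPowerSeries ℤ C s) =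
        HahnSeries.ofPowerSeries ℤ C ((PowerSeries.derivative C)^[k] s) := by
    intro k s
    rw [map_pow, aeval_X, Module.End.pow_apply, ← iterate_deriv_ofPowerSeries]
    rfl
  rw [h3, h3, ← map_mul, HahnSeries.ofPowerSeries_apply_coeff, 
    PowerSeries.coeff_zero_eq_constantCoeff_apply, map_mul,
    ← PowerSeries.coeff_zero_eq_constantCoeff_apply, ← PowerSeries.coeff_zero_eq_constantCoeff_apply,
    hf.constantCoeff_iterate, hg.constantCoeff_iterate]

-- Evaluating at the pair (fᵢ, gⱼ) sends the element to w(D)(fᵢ gⱼ) = 0, while the constant term of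
-- the image is its (i, j) coordinate times i! j!. So all coordinates vanish. This identity no
-- longer mentions Laurent series.
open TensorProduct in
theorem aeval_root_tmul_eq_zero [CharZero C] {p q w : C[X]} (hp : p ≠ 0) (hq : q ≠ 0)
    (h : ∀ f ∈ solutionSpace (p.map RatFunc.C), ∀ g ∈ solutionSpace (q.map RatFunc.C),
      f * g ∈ solutionSpace (w.map RatFunc.C)) :
    aeval (AdjoinRoot.root p ⊗ₜ[C] (1 : AdjoinRoot q) +
        (1 : AdjoinRoot p) ⊗ₜ[C] AdjoinRoot.root q) w = 0 := by
  obtain ⟨f, hf, hfp⟩ := exists_fundamentalSystem_map_C hp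
  obtain ⟨g, hg, hgq⟩ := exists_fundamentalSystem_map_C hq
  obtain ⟨b₁, hb₁⟩ := exists_basis_adjoinRoot hp
  obtain ⟨b₂, hb₂⟩ := exists_basis_adjoinRoot hq
  obtain ⟨b, hb⟩ : ∃ b : Module.Basis (Fin p.natDegree × Fin q.natDegree) C
      (AdjoinRoot p ⊗[C] AdjoinRoot q), ∀ k l, b (k, l) =
        AdjoinRoot.mk p (X ^ (k : ℕ)) ⊗ₜ AdjoinRoot.mk q (X ^ (l : ℕ)) :=
    ⟨b₁.tensorProduct b₂, fun k l => by rw [Module.Basis.tensorProduct_apply, hb₁, hb₂]⟩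
  set u := aeval (AdjoinRoot.root p ⊗ₜ[C] (1 : AdjoinRoot q) +
        (1 : AdjoinRoot p) ⊗ₜ[C] AdjoinRoot.root q) w with hu
  have hrep : ∀ i j, b.repr u (i, j) = 0 := by
    intro i j
    have hmem := h _ (hfp i) _ (hgq j)
    have hfi := hfp i
    have hgj := hgq j
    rw [mem_solutionSpace_map_C] at hmem hfi hgj
    obtain ⟨Φ, hΦ1, hΦ2⟩ := exists_tensor_map (F := C⸨X⸩)
      (fun c f => by rw [algebraMap_ratFunc_C_laurentSeries, HahnSeries.C_mul_eq_smul])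
      (LaurentSeries.derivative C) (fun _ => rfl) hfi hgj
    have h1 := hΦ2 w
    rw [← hu, hmem, ← b.sum_repr u, map_sum] at h1
    have h2 := congrArg (fun s : C⸨X⸩ => s.coeff ((0 : ℕ) : ℤ)) h1
    have h4 : ∀ k l, (Φ (b (k, l))).coeff ((0 : ℕ) : ℤ) =
        (if k = i then ∏ a ∈ Finset.range k, ((0 + 1 + a : ℕ) : C) else 0) *
          (if l = j then ∏ a ∈ Finset.range l, ((0 + 1 + a : ℕ) : C) else 0) := fun k l => by
      rw [hb, hΦ1]
      exact coeff_aeval_X_pow_mul hf hg k i l j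
    simp only [HahnSeries.coeff_sum, HahnSeries.coeff_zero, map_smul, HahnSeries.coeff_smul] at h2
    rw [Finset.sum_eq_single (i, j), h4, if_pos rfl, if_pos rfl, smul_eq_mul] at h2
    · have hne : ∀ n : ℕ, (∏ a ∈ Finset.range n, ((0 + 1 + a : ℕ) : C)) ≠ 0 := fun n =>
        Finset.prod_ne_zero_iff.mpr fun a _ => Nat.cast_ne_zero.mpr (by omega)
      exact (mul_eq_zero.mp h2).resolve_right (mul_ne_zero (hne _) (hne _))
    · rintro ⟨k, l⟩ - hkl
      rw [h4]
      by_cases hk : k = i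
      · rw [if_neg (show l ≠ j from fun hl => hkl (by rw [hk, hl])), mul_zero, smul_zero]
      · rw [if_neg hk, zero_mul, smul_zero]
    · intro hn
      exact absurd (Finset.mem_univ _) hn
  rw [← b.sum_repr u]
  exact Finset.sum_eq_zero fun x _ => by rw [hrep x.1 x.2, zero_smul]

/-- An operator with constant coefficients that annihilates the products of solutions in `C((x))`
annihilates them in every differential extension. -/
theorem annihilatesProducts_map_C [CharZero C] {p q w : C[X]} (hp : p ≠ 0) (hq : q ≠ 0)
    (h : ∀ f ∈ solutionSpace (p.map RatFunc.C), ∀ g ∈ solutionSpace (q.map RatFunc.C),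
      f * g ∈ solutionSpace (w.map RatFunc.C)) :
    AnnihilatesProducts (p.map RatFunc.C) (q.map RatFunc.C) (w.map RatFunc.C) := by
  intro F _ _ _ _ f g hf hg
  -- Through C(x), elements of C become constants of F, so the derivation of F is C-linear.
  let ι : C →+* F := (algebraMap (RatFunc C) F).comp RatFunc.C
  let _ : Module C F := Module.compHom F ι
  have hsmul : ∀ (c : C) (f : F), c • f = algebraMap (RatFunc C) F (RatFunc.C c) * f :=
    fun c f => rfl
  have hC : ∀ c : C, (algebraMap (RatFunc C) F (RatFunc.C c))′ = 0 := by
    intro c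
    rw [deriv_algebraMap, ratFunc_C_deriv, map_zero]
  let D : Module.End C F :=
    { toFun := fun f => (f′)
      map_add' := map_add _
      map_smul' := fun c f => by
        rw [hsmul, Derivation.leibniz, hC, smul_zero, add_zero]
        rfl }
  rw [act_map_C hsmul D fun _ => rfl] at hf hg ⊢
  obtain ⟨Φ, -, hΦ⟩ := exists_tensor_map hsmul D (fun _ => rfl) hf hg
  rw [← hΦ w, aeval_root_tmul_eq_zero hp hq h, map_zero]

/-! ### Products and right factors in `C[D]` -/

theorem derivComp_map_C (b : C[X]) : derivComp (b.map RatFunc.C) = (X * b).map RatFunc.C := by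
  induction b using Polynomial.induction_on' with
  | add p q hp hq =>
    rw [mul_add, Polynomial.map_add, Polynomial.map_add, ← hp, ← hq]
    unfold derivComp
    rw [Polynomial.sum_add_index _ _ _ (by simp) (by intros; simp only [map_add]; ring)]
  | monomial n a =>
    rw [X_mul_monomial, map_monomial, map_monomial]
    unfold derivComp
    rw [Polynomial.sum_monomial_index _ _ (by simp), ratFunc_C_deriv, map_zero, add_zero]

/-- The product of operators with constant coefficients is the product of polynomials. -/
theorem mulOp_map_C (a b : C[X]) :
    mulOp (a.map RatFunc.C) (b.map RatFunc.C) = (a * b).map RatFunc.C := by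
  have hiter : ∀ n : ℕ, derivComp^[n] (b.map RatFunc.C) = (X ^ n * b).map RatFunc.C := by
    intro n
    induction n with
    | zero => simp
    | succ n ih => rw [Function.iterate_succ_apply', ih, derivComp_map_C, pow_succ', mul_assoc]
  induction a using Polynomial.induction_on' with
  | add p q hp hq =>
    rw [add_mul, Polynomial.map_add, Polynomial.map_add, ← hp, ← hq]
    unfold mulOp
    rw [Polynomial.sum_add_index _ _ _ (by simp) (by intros; rw [map_add, add_mul])]
  | monomial n a =>
    unfold mulOp
    rw [map_monomial, Polynomial.sum_monomial_index _ _ (by simp), hiter, ← C_mul_X_pow_eq_monomial,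
      mul_assoc]
    conv_rhs => rw [Polynomial.map_mul, map_C]

/-- The remainder of m modulo w annihilates V(w) but has smaller order than w, so it is zero. -/
theorem isRightFactor_map_C [CharZero C] {w m : C[X]} (hw : w.Monic)
    (h : solutionSpace (w.map RatFunc.C) ≤ solutionSpace (m.map RatFunc.C)) :
    IsRightFactor (w.map RatFunc.C) (m.map RatFunc.C) := by
  have hr : m %ₘ w = 0 := by
    by_contra h0
    have h1 : (m %ₘ w).map (RatFunc.C (K := C)) ≠ 0 := by
      rwa [Ne, Polynomial.map_eq_zero]
    have h2 := natDegree_ge_of_act_eq_zero hw h1 fun f hf => by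
      have h3 := h hf
      rw [mem_solutionSpace_map_C] at h3 hf
      rw [act_map_C_laurentSeries]
      rw [← modByMonic_add_div m w, map_add, mul_comm, map_mul, LinearMap.add_apply,
        Module.End.mul_apply, hf, map_zero, add_zero] at h3
      exact h3
    rw [natDegree_map] at h2
    rcases eq_or_ne w 1 with rfl | hw1
    · exact h0 (modByMonic_one m)
    · exact absurd (natDegree_modByMonic_lt m hw hw1) (not_lt.mpr h2)
  refine ⟨(m /ₘ w).map RatFunc.C, ?_⟩
  rw [mulOp_map_C]
  conv_lhs => rw [← modByMonic_add_div m w, hr, zero_add, mul_comm]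

theorem laurentSeries_deriv_mul (f g : C⸨X⸩) : (f * g)′ = f * g′ + g * f′ :=
  laurentSeries_derivative_mul f g

/-- The multiplication of Laurent series as a bilinear map. -/
def laurentMul : C⸨X⸩ →ₗ[C] C⸨X⸩ →ₗ[C] C⸨X⸩ :=
  LinearMap.mk₂ C (fun f g => f * g) add_mul
    (fun c f g => by rw [← HahnSeries.C_mul_eq_smul, ← HahnSeries.C_mul_eq_smul, mul_assoc])
    mul_add
    (fun c f g => by rw [← HahnSeries.C_mul_eq_smul, ← HahnSeries.C_mul_eq_smul, mul_left_comm])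

theorem deriv_mem_solutionSpace_map_C {p : C[X]} {f : C⸨X⸩}
    (hf : f ∈ solutionSpace (p.map RatFunc.C)) : f′ ∈ solutionSpace (p.map RatFunc.C) := by
  rw [mem_solutionSpace_map_C] at hf ⊢
  rw [laurentSeries_deriv_eq]
  have h : LaurentSeries.derivative C f = aeval (LaurentSeries.derivative C) (X : C[X]) f := by
    rw [aeval_X]
  rw [h, ← Module.End.mul_apply, ← map_mul, mul_comm, map_mul, Module.End.mul_apply, hf, map_zero]

/-- The symmetric product of operators with constant coefficients is the monic operator with
constant coefficients whose solution space is spanned by the products of solutions. -/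
theorem exists_isSymProduct_map_C [CharZero C] {p q : C[X]} (hp : p ≠ 0) (hq : q ≠ 0) :
    ∃ w : C[X], w.Monic ∧
      (∀ S, IsSymProduct (p.map RatFunc.C) (q.map RatFunc.C) S ↔ S = w.map RatFunc.C) ∧
      solutionSpace (w.map RatFunc.C) = Submodule.map₂ laurentMul
        (solutionSpace (p.map RatFunc.C)) (solutionSpace (q.map RatFunc.C)) := by
  set W := Submodule.map₂ laurentMul
        (solutionSpace (p.map RatFunc.C)) (solutionSpace (q.map RatFunc.C)) with hW
  have hfp := finite_solutionSpace hp
  have hfq := finite_solutionSpace hq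
  have : Module.Finite C W :=
    Module.Finite.iff_fg.mpr ((Module.Finite.iff_fg.mp hfp).map₂ _ (Module.Finite.iff_fg.mp hfq))
  have hmem : ∀ f ∈ solutionSpace (p.map RatFunc.C), ∀ g ∈ solutionSpace (q.map RatFunc.C),
      f * g ∈ W := fun f hf g hg => Submodule.apply_mem_map₂ laurentMul hf hg
  have hder : W ≤ W.comap (LaurentSeries.derivative C) := by
    refine Submodule.map₂_le.mpr fun f hf g hg => ?_
    change (f * g)′ ∈ W
    rw [laurentSeries_deriv_mul, mul_comm g]
    exact W.add_mem (hmem _ hf _ (deriv_mem_solutionSpace_map_C hg))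
      (hmem _ (deriv_mem_solutionSpace_map_C hf) _ hg)
  obtain ⟨w, hw, -, hwW⟩ := exists_solutionSpace_eq W fun f hf => hder hf
  have hann : AnnihilatesProducts (p.map RatFunc.C) (q.map RatFunc.C) (w.map RatFunc.C) :=
    annihilatesProducts_map_C hp hq (by rwa [hwW])
  have hkill : ∀ S : DiffOp C, AnnihilatesProducts (p.map RatFunc.C) (q.map RatFunc.C) S →
      ∀ f ∈ solutionSpace (w.map RatFunc.C), S.act f = 0 := by
    intro S hS
    rw [hwW]
    -- The field C((x)) is itself one of the extensions over which S is tested.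
    have h1 : W ≤ S.solutionSpace := Submodule.map₂_le.mpr fun f hf g hg => hS C⸨X⸩ f g hf hg
    exact fun f hf => h1 hf
  have hmin : ∀ T : DiffOp C, T ≠ 0 → AnnihilatesProducts (p.map RatFunc.C) (q.map RatFunc.C) T →
      (w.map (RatFunc.C (K := C))).natDegree ≤ T.natDegree := by
    intro T hT hTa
    rw [natDegree_map]
    exact natDegree_ge_of_act_eq_zero hw hT (hkill T hTa)
  refine ⟨w, hw, fun S => ⟨fun hS => ?_, ?_⟩, hwW⟩
  · obtain ⟨hS1, hS2, hS3⟩ := hS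
    have h1 := hS3 _ (isPrimitiveOp_map_C hw).ne_zero hann
    rw [natDegree_map] at h1
    exact hS1.eq_map_C hw (eq_C_mul_of_act_eq_zero hw h1 (hkill S hS2))
  · rintro rfl
    exact ⟨isPrimitiveOp_map_C hw, hann, hmin⟩

/-- The last member of the fundamental system attains the largest order that a solution can have. -/
theorem exists_order_eq [CharZero C] {p : C[X]} (hp : 0 < p.natDegree) :
    ∃ f ∈ solutionSpace (p.map RatFunc.C), f ≠ 0 ∧ f.order = p.natDegree - 1 := by
  have hp0 : p ≠ 0 := by
    rintro rfl
    simp at hp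
  obtain ⟨f, hf, hfp⟩ := exists_fundamentalSystem_map_C hp0
  set j : Fin p.natDegree := ⟨p.natDegree - 1, by omega⟩ with hj
  have hne : HahnSeries.ofPowerSeries ℤ C (f j) ≠ 0 := by
    intro h0
    have h1 := hf j j
    rw [if_pos rfl, ← HahnSeries.ofPowerSeries_apply_coeff (Γ := ℤ), h0, HahnSeries.coeff_zero] at h1
    exact zero_ne_one h1
  refine ⟨_, hfp j, hne, ?_⟩
  obtain ⟨h1, h2⟩ := order_mem_Ico_of_mem_solutionSpace hp0 (hfp j) hne
  by_contra h3
  apply hne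
  rw [← HahnSeries.coeff_order_eq_zero]
  obtain ⟨k, hk⟩ := Int.eq_ofNat_of_zero_le h1
  have hk2 : k < p.natDegree := by omega
  have h4 := hf ⟨k, hk2⟩ j
  rw [if_neg (by rw [hj, Fin.mk.injEq]; omega)] at h4
  rw [hk, HahnSeries.ofPowerSeries_apply_coeff]
  exact h4

/-- Solutions of maximal order n - 1 on both sides have a product whose order is the sum, and this
must stay below the order of w. -/
theorem natDegree_add_le_of_mul_mem [CharZero C] {p q w : C[X]} (hp : 0 < p.natDegree)
    (hq : 0 < q.natDegree) (hw : w ≠ 0)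
    (h : ∀ f ∈ solutionSpace (p.map RatFunc.C), ∀ g ∈ solutionSpace (q.map RatFunc.C),
      f * g ∈ solutionSpace (w.map RatFunc.C)) : p.natDegree + q.natDegree ≤ w.natDegree + 1 := by
  obtain ⟨f, hf, hf0, hfo⟩ := exists_order_eq hp
  obtain ⟨g, hg, hg0, hgo⟩ := exists_order_eq hq
  have h1 := (order_mem_Ico_of_mem_solutionSpace hw (h f hf g hg) (mul_ne_zero hf0 hg0)).2
  rw [HahnSeries.order_mul hf0 hg0, hfo, hgo] at h1
  omega

/-! ### The colon space and the quotient -/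

/-- Multiplication by one nonzero solution of l embeds the colon space into V(m). -/
theorem finite_colonSpace [CharZero C] {l m : C[X]} (hl : 0 < l.natDegree) (hm : m ≠ 0) :
    Module.Finite C (colonSpace (m.map RatFunc.C) (l.map RatFunc.C)) := by
  obtain ⟨g, hg, hg0, -⟩ := exists_order_eq hl
  have := finite_solutionSpace hm
  let φ : colonSpace (m.map RatFunc.C) (l.map RatFunc.C) →ₗ[C] solutionSpace (m.map RatFunc.C) :=
    ((laurentMul.flip g).comp (Submodule.subtype _)).codRestrict _ fun h => h.2 g hg
  refine Module.Finite.of_injective φ fun a b hab => Subtype.ext ?_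
  exact mul_right_cancel₀ hg0 (congrArg Subtype.val hab)

theorem exists_solutionSpace_eq_colonSpace [CharZero C] {l m : C[X]} (hl : 0 < l.natDegree)
    (hm : m ≠ 0) : ∃ q : C[X], q.Monic ∧
      q.natDegree = Module.finrank C (colonSpace (m.map RatFunc.C) (l.map RatFunc.C)) ∧
      solutionSpace (q.map RatFunc.C) = colonSpace (m.map RatFunc.C) (l.map RatFunc.C) := by
  have := finite_colonSpace hl hm
  refine exists_solutionSpace_eq _ fun h hh g hg => ?_
  have h1 : h′ * g = (h * g)′ - h * g′ := by
    rw [laurentSeries_deriv_mul]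
    ring
  rw [h1]
  exact Submodule.sub_mem _ (deriv_mem_solutionSpace_map_C (hh g hg))
    (hh _ (deriv_mem_solutionSpace_map_C hg))

theorem symProductDivides_map_C [CharZero C] {l q m : C[X]} (hl : l ≠ 0) (hq : q ≠ 0)
    (h : solutionSpace (q.map RatFunc.C) ≤ colonSpace (m.map RatFunc.C) (l.map RatFunc.C)) :
    SymProductDivides (l.map RatFunc.C) (q.map RatFunc.C) (m.map RatFunc.C) := by
  obtain ⟨w, hw, hS, hV⟩ := exists_isSymProduct_map_C hl hq
  refine ⟨_, (hS _).mpr rfl, isRightFactor_map_C hw ?_⟩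
  rw [hV]
  refine Submodule.map₂_le.mpr fun f hf g hg => ?_
  have h1 := h hg f hf
  rwa [mul_comm] at h1

theorem SymProductDivides.act_mul_eq_zero {L P M : DiffOp C} (h : SymProductDivides L P M)
    {F : Type u} [CommRing F] [Differential F] [Algebra (RatFunc C) F]
    [DifferentialAlgebra (RatFunc C) F] {f g : F} (hf : L.act f = 0) (hg : P.act g = 0) :
    M.act (f * g) = 0 := by
  obtain ⟨S, ⟨-, hS, -⟩, R, rfl⟩ := h
  rw [act_mulOp, hS F f g hf hg]
  simp [act, Polynomial.sum, iterate_map_zero]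

/-! ### Expansion at another point -/

theorem laurent_deriv (ξ : C) (f : RatFunc C) :
    (RatFunc.laurent ξ f)′ = RatFunc.laurent ξ (f′) := by
  change ratDeriv _ = RatFunc.laurent ξ (ratDeriv f)
  have hd : taylor ξ f.denom ≠ 0 := fun h0 =>
    f.denom_ne_zero (taylor_injective ξ (h0.trans (map_zero _).symm))
  have ht : ∀ p : C[X], derivative (taylor ξ p) = taylor ξ (derivative p) := by
    intro p
    rw [taylor_apply, taylor_apply, derivative_comp]
    simp
  conv_lhs => rw [← RatFunc.num_div_denom f]
  rw [RatFunc.laurent_div, ratDeriv_div _ _ hd, ratDeriv, RatFunc.laurent_div, ht, ht]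
  simp only [map_sub, taylor_mul, taylor_pow]

/-- `C((x))` as an algebra over `C(x)` by expansion at `ξ`. -/
abbrev shiftAlgebra (ξ : C) : Algebra (RatFunc C) C⸨X⸩ :=
  ((algebraMap (RatFunc C) C⸨X⸩).comp (RatFunc.laurent ξ).toRingHom).toAlgebra

theorem act_shiftAlgebra (ξ : C) (A : DiffOp C) (f : C⸨X⸩) :
    @act C _ C⸨X⸩ _ _ (shiftAlgebra ξ) A f = (A.shift ξ).act f := by
  rw [act_eq_sum_range (A.shift ξ) (n := A.natDegree + 1) (Nat.lt_succ_of_le natDegree_map_le),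
    @act_eq_sum_range C _ C⸨X⸩ _ _ (shiftAlgebra ξ) A _ (Nat.lt_succ_self _)]
  refine Finset.sum_congr rfl fun i _ => ?_
  rw [shift, coeff_map]
  rfl

theorem differentialAlgebra_shiftAlgebra (ξ : C) :
    @DifferentialAlgebra (RatFunc C) C⸨X⸩ _ _ (shiftAlgebra ξ) _ _ := by
  refine @DifferentialAlgebra.mk (RatFunc C) C⸨X⸩ _ _ (shiftAlgebra ξ) _ _ fun a => ?_
  change (algebraMap (RatFunc C) C⸨X⸩ (RatFunc.laurent ξ a))′ =
    algebraMap (RatFunc C) C⸨X⸩ (RatFunc.laurent ξ (a′))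
  rw [deriv_algebraMap, laurent_deriv]

/-- The defining property of a symmetric product covers all differential extensions, in particular
C((x)) with rational functions expanded at ξ. Hence compatibility of ⊗ with shifts is not needed. -/
theorem SymProductDivides.shift_act_mul_eq_zero {L P M : DiffOp C} (h : SymProductDivides L P M)
    (ξ : C) {f g : C⸨X⸩} (hf : (L.shift ξ).act f = 0) (hg : (P.shift ξ).act g = 0) :
    (M.shift ξ).act (f * g) = 0 := by
  rw [← act_shiftAlgebra] at hf hg ⊢
  exact @SymProductDivides.act_mul_eq_zero C _ L P M h C⸨X⸩ _ _ (shiftAlgebra ξ)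
    (differentialAlgebra_shiftAlgebra ξ) f g hf hg

theorem shift_map_C (ξ : C) (p : C[X]) : shift ξ (p.map RatFunc.C) = p.map RatFunc.C := by
  rw [shift, Polynomial.map_map]
  congr 1
  ext c
  exact RatFunc.laurent_C ξ c

/-- Near a suitable ξ, P has as many independent power series solutions as its order, all in the
colon space. If they fill it, the shifted P annihilates V(q) and is a multiple of q(D). -/
theorem natDegree_le_finrank_colonSpace [CharZero C] {l m q : C[X]} (hl : 0 < l.natDegree)
    (hm : m ≠ 0) (hq : q.Monic)
    (hqd : q.natDegree = Module.finrank C (colonSpace (m.map RatFunc.C) (l.map RatFunc.C)))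
    (hqV : solutionSpace (q.map RatFunc.C) = colonSpace (m.map RatFunc.C) (l.map RatFunc.C))
    {P : DiffOp C} (hP : P ≠ 0)
    (h : SymProductDivides (l.map RatFunc.C) P (m.map RatFunc.C)) :
    P.natDegree ≤ q.natDegree ∧
      (P.natDegree = q.natDegree → P.IsPrimitiveOp → P = q.map RatFunc.C) := by
  have := finite_colonSpace hl hm
  obtain ⟨c, hc, p, hpd, hpP⟩ := exists_C_mul_eq_map P
  have hp0 : p ≠ 0 := by
    rintro rfl
    rw [Polynomial.map_zero] at hpP
    exact mul_ne_zero (C_ne_zero.mpr (RatFunc.algebraMap_ne_zero hc)) hP hpP.symm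
  obtain ⟨ξ, hξ⟩ : ∃ ξ, p.leadingCoeff.eval ξ ≠ 0 := by
    by_contra! hall
    exact leadingCoeff_ne_zero.mpr hp0 (Polynomial.funext fun x => by rw [hall x, eval_zero])
  have htinj : Function.Injective (taylorAlgHom ξ : C[X] →ₐ[C] C[X]).toRingHom := taylor_injective ξ
  set pξ := p.map (taylorAlgHom ξ : C[X] →ₐ[C] C[X]).toRingHom with hpξ
  have hpξd : pξ.natDegree = P.natDegree := by
    rw [hpξ, natDegree_map_eq_of_injective htinj, hpd]
  have hpξP : pξ.map (algebraMap C[X] (RatFunc C)) =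
      Polynomial.C (RatFunc.laurent ξ (algebraMap C[X] (RatFunc C) c)) * P.shift ξ := by
    have h1 := congrArg (Polynomial.map (RatFunc.laurent ξ).toRingHom) hpP
    rw [Polynomial.map_mul, map_C, Polynomial.map_map] at h1
    rw [hpξ, Polynomial.map_map, shift]
    refine Eq.trans ?_ h1
    congr 1
    exact RingHom.ext fun a => (RatFunc.laurent_algebraMap ξ a).symm
  obtain ⟨f, hf, hfV⟩ := exists_fundamentalSystem pξ (by
    rw [hpξ, leadingCoeff_map_of_injective htinj]
    change (taylor ξ p.leadingCoeff).eval 0 ≠ 0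
    rwa [taylor_eval, zero_add])
  have hfP : ∀ j, (P.shift ξ).act (HahnSeries.ofPowerSeries ℤ C (f j)) = 0 := by
    intro j
    have h1 := hfV j
    rw [mem_solutionSpace, hpξP, act_C_mul] at h1
    refine (mul_eq_zero.mp h1).resolve_left ?_
    rw [← ne_eq, _root_.map_ne_zero, RatFunc.laurent_algebraMap]
    exact RatFunc.algebraMap_ne_zero fun h0 => hc (taylor_injective ξ (h0.trans (map_zero _).symm))
  -- Shifting fixes both operators with constant coefficients, so solutions of P expanded at ξ lie
  -- in the colon space formed at 0.
  have hfc : ∀ j, HahnSeries.ofPowerSeries ℤ C (f j) ∈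
      colonSpace (m.map RatFunc.C) (l.map RatFunc.C) := by
    intro j g hg
    have h1 := h.shift_act_mul_eq_zero ξ (f := g) (by rwa [shift_map_C]) (hfP j)
    rwa [shift_map_C, mul_comm] at h1
  set v : Fin pξ.natDegree → colonSpace (m.map RatFunc.C) (l.map RatFunc.C) :=
    fun j => ⟨_, hfc j⟩ with hv
  have hli : LinearIndependent C v := by
    rw [Fintype.linearIndependent_iff]
    intro a ha i
    have h1 := congrArg (fun s : colonSpace (m.map RatFunc.C) (l.map RatFunc.C) =>
      (s : C⸨X⸩).coeff ((i : ℕ) : ℤ)) ha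
    simp only [Submodule.coe_sum, Submodule.coe_smul, HahnSeries.coeff_sum, HahnSeries.coeff_smul,
      ZeroMemClass.coe_zero, HahnSeries.coeff_zero, hv, HahnSeries.ofPowerSeries_apply_coeff,
      hf i, smul_eq_mul, mul_ite, mul_one, mul_zero, Finset.sum_ite_eq, Finset.mem_univ,
      if_true] at h1
    exact h1
  have hle := hli.fintype_card_le_finrank
  rw [Fintype.card_fin, hpξd, ← hqd] at hle
  refine ⟨hle, fun hPd hprim => ?_⟩
  have hspan := hli.span_eq_top_of_card_eq_finrank' (by rw [Fintype.card_fin, hpξd, hPd, hqd])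
  have hkill : ∀ g ∈ solutionSpace (q.map RatFunc.C), (P.shift ξ).act g = 0 := by
    have h1 : (⊤ : Submodule C (colonSpace (m.map RatFunc.C) (l.map RatFunc.C))) ≤
        (P.shift ξ).solutionSpace.comap (Submodule.subtype _) := by
      rw [← hspan, Submodule.span_le]
      rintro _ ⟨j, rfl⟩
      exact hfP j
    intro g hg
    rw [hqV] at hg
    have h2 := h1 (Submodule.mem_top (x := ⟨g, hg⟩))
    exact h2
  have h1 := eq_C_mul_of_act_eq_zero hq (P := P.shift ξ) (by
    rw [shift, natDegree_map, hPd]) hkill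
  refine hprim.eq_map_C hq (a := P.coeff q.natDegree) ?_
  refine Polynomial.map_injective (RatFunc.laurent ξ).toRingHom (RatFunc.laurent_injective ξ) ?_
  change shift ξ P = shift ξ (Polynomial.C (P.coeff q.natDegree) * q.map RatFunc.C)
  rw [h1, shift, shift, Polynomial.map_mul, map_C, coeff_map]
  congr 1
  exact (shift_map_C ξ q).symm

/-! ### Symmetric powers and the indicial polynomial -/

/-- Each further factor raises the order by at least ord(L) - 1. The empty power `D` starts the
count at order 1. -/
theorem exists_isSymPower_map_C [CharZero C] {l : C[X]} (hl : 0 < l.natDegree) (s : ℕ) :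
    (∃ P, IsSymPower (l.map RatFunc.C) s P) ∧ ∀ P, IsSymPower (l.map RatFunc.C) s P →
      ∃ p : C[X], P = p.map RatFunc.C ∧ s * (l.natDegree - 1) + 1 ≤ p.natDegree := by
  have hl0 : l ≠ 0 := ne_zero_of_natDegree_gt hl
  match s with
  | 0 => exact ⟨⟨X, rfl⟩, fun P hP => ⟨X, by rw [map_X]; exact hP, by simp⟩⟩
  | 1 => exact ⟨⟨_, rfl⟩, fun P hP => ⟨l, hP, by omega⟩⟩
  | s + 2 =>
    obtain ⟨⟨P, hP⟩, ih⟩ := exists_isSymPower_map_C hl (s + 1)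
    constructor
    · obtain ⟨p, rfl, hp⟩ := ih P hP
      obtain ⟨w, -, hw, -⟩ := exists_isSymProduct_map_C hl0
        (ne_zero_of_natDegree_gt (lt_of_lt_of_le (Nat.succ_pos _) hp))
      exact ⟨_, _, hP, (hw _).mpr rfl⟩
    · rintro S ⟨P', hP', hS⟩
      obtain ⟨p, rfl, hp⟩ := ih P' hP'
      have hp0 : 0 < p.natDegree := lt_of_lt_of_le (Nat.succ_pos _) hp
      obtain ⟨w, hw1, hw, hV⟩ := exists_isSymProduct_map_C hl0 (ne_zero_of_natDegree_gt hp0)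
      refine ⟨w, (hw S).mp hS, ?_⟩
      have h1 := natDegree_add_le_of_mul_mem hl hp0 hw1.ne_zero fun f hf g hg => by
        rw [hV]
        exact Submodule.apply_mem_map₂ laurentMul hf hg
      have h2 : (s + 2) * (l.natDegree - 1) = (s + 1) * (l.natDegree - 1) + (l.natDegree - 1) := by
        ring
      omega

theorem shiftPoly_map_C (w : C[X]) (m : ℤ) :
    shiftPoly (w.map RatFunc.C) m = ∑ i ∈ Finset.range (w.natDegree + 1),
      Polynomial.C (if m + i = 0 then w.coeff i else 0) * descPochhammer C i := by
  unfold shiftPoly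
  rw [Polynomial.sum_over_range' _ (fun n => by simp) (w.natDegree + 1)
    (Nat.lt_succ_of_le natDegree_map_le)]
  refine Finset.sum_congr rfl fun i _ => ?_
  rw [coeff_map, algebraMap_ratFunc_C_laurentSeries, HahnSeries.C_apply, HahnSeries.coeff_single]
  congr

/-- For a monic w of degree n with constant coefficients, the lowest term of w(D) x^s comes from `D
^ n` alone. The indicial polynomial is thus s(s-1)⋯(s-n+1), with roots 0, …, n-1. -/
theorem isMaxIndicialRoot_map_C [CharZero C] {w : C[X]} (hw : w.Monic) (z : ℕ) :
    IsMaxIndicialRoot (w.map RatFunc.C) z ↔ z + 1 = w.natDegree := by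
  have hlow : ∀ m < -(w.natDegree : ℤ), shiftPoly (w.map RatFunc.C) m = 0 := by
    intro m hm
    rw [shiftPoly_map_C]
    refine Finset.sum_eq_zero fun i hi => ?_
    rw [Finset.mem_range] at hi
    rw [if_neg (by omega), C_0, zero_mul]
  have htop : shiftPoly (w.map RatFunc.C) (-(w.natDegree : ℤ)) = descPochhammer C w.natDegree := by
    rw [shiftPoly_map_C, Finset.sum_range_succ, Finset.sum_eq_zero, zero_add,
      if_pos (neg_add_cancel _), hw.coeff_natDegree, C_1, one_mul]
    intro i hi
    rw [Finset.mem_range] at hi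
    rw [if_neg (by omega), C_0, zero_mul]
  have hne : descPochhammer C w.natDegree ≠ 0 := (monic_descPochhammer C _).ne_zero
  have hind : ∀ p, IsIndicialPoly (w.map RatFunc.C) p ↔ p = descPochhammer C w.natDegree := by
    intro p
    constructor
    · rintro ⟨σ, rfl, h0, hσ⟩
      rcases lt_trichotomy σ (-(w.natDegree : ℤ)) with h | rfl | h
      · exact absurd (hlow σ h) h0
      · exact htop
      · exact absurd (htop.symm.trans (hσ _ h)) hne
    · rintro rfl
      exact ⟨_, htop.symm, hne, hlow⟩
  have hset : {k : ℕ | (descPochhammer C w.natDegree).eval (k : C) = 0} = {k | k < w.natDegree} := by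
    ext k
    rw [Set.mem_ofPred_eq, Set.mem_ofPred_eq, descPochhammer_eval_eq_descFactorial, Nat.cast_eq_zero,
      Nat.descFactorial_eq_zero_iff_lt]
  have h1 : IsMaxIndicialRoot (w.map RatFunc.C) z ↔ IsGreatest {k | k < w.natDegree} z := by
    unfold IsMaxIndicialRoot
    simp only [hind, exists_eq_left, hset]
  rw [h1]
  constructor
  · rintro ⟨h2, h3⟩
    rw [Set.mem_ofPred_eq] at h2
    by_contra h4
    have h5 := h3 (show z + 1 < w.natDegree by omega)
    omega
  · intro h2
    refine ⟨by rw [Set.mem_ofPred_eq]; omega, fun k hk => ?_⟩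
    rw [Set.mem_ofPred_eq] at hk
    omega

/-! ### Truncated solutions -/

/-- The action of an operator on Laurent series as a linear map. -/
def actLinear (L : DiffOp C) : C⸨X⸩ →ₗ[C] C⸨X⸩ :=
  ∑ i ∈ Finset.range (L.natDegree + 1),
    (laurentMul (algebraMap (RatFunc C) C⸨X⸩ (L.coeff i))).comp (LaurentSeries.derivative C ^ i)

theorem actLinear_apply (L : DiffOp C) (f : C⸨X⸩) : L.actLinear f = L.act f := by
  rw [actLinear, LinearMap.sum_apply, act_eq_sum_range L (Nat.lt_succ_self _)]
  refine Finset.sum_congr rfl fun i _ => ?_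
  rw [LinearMap.comp_apply, Module.End.pow_apply]
  rfl

theorem coeff_ofPowerSeries_mul_eq_zero (s : PowerSeries C) {g : C⸨X⸩} {K : ℤ}
    (hg : ∀ i < K, g.coeff i = 0) {i : ℤ} (hi : i < K) :
    (HahnSeries.ofPowerSeries ℤ C s * g).coeff i = 0 := by
  rw [HahnSeries.coeff_mul]
  refine Finset.sum_eq_zero fun ab hab => ?_
  rw [Finset.mem_antidiagonal] at hab
  obtain ⟨ha, hb, hab⟩ := hab
  have h0 : ¬ ab.1 < 0 := by
    intro h0
    rw [HahnSeries.mem_support, PowerSeries.coeff_coe, if_pos h0] at ha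
    exact ha rfl
  rw [hg ab.2 (by omega), mul_zero]

/-- Operators with polynomial coefficients lose at most their order in precision. -/
theorem coeff_act_eq_zero {q : C[X][X]} {n : ℕ} (hq : q.natDegree ≤ n) {g : C⸨X⸩} {K : ℤ}
    (hg : ∀ i < K, g.coeff i = 0) {i : ℤ} (hi : i < K - n) :
    (act (q.map (algebraMap C[X] (RatFunc C))) g).coeff i = 0 := by
  rw [act_eq_sum_range _ (Nat.lt_succ_of_le (natDegree_map_le.trans hq)), HahnSeries.coeff_sum]
  refine Finset.sum_eq_zero fun j hj => ?_
  rw [Finset.mem_range] at hj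
  rw [coeff_map, algebraMap_polynomial_laurentSeries]
  refine coeff_ofPowerSeries_mul_eq_zero (K := K - n) _ (fun a ha => ?_) hi
  have h1 : (fun g : C⸨X⸩ => g′)^[j] g = (LaurentSeries.derivative C ^ j) g := by
    rw [Module.End.pow_apply]
    rfl
  rw [h1, coeff_derivative_pow, hg _ (by omega), mul_zero]

/-- The discarded tail begins beyond x^k and loses at most n orders under the action, so it is
invisible below x^(k-n). -/
theorem coeff_act_truncAt {q : C[X][X]} {n : ℕ} (hq : q.natDegree ≤ n) (g : C⸨X⸩) (k : ℤ) {i : ℤ}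
    (hi : i < k - n) :
    (act (q.map (algebraMap C[X] (RatFunc C))) (truncAt k g)).coeff i =
      (act (q.map (algebraMap C[X] (RatFunc C))) g).coeff i := by
  rw [← sub_eq_zero, ← HahnSeries.coeff_sub, ← actLinear_apply, ← actLinear_apply, ← map_sub,
    actLinear_apply]
  refine coeff_act_eq_zero hq (K := k) (fun a ha => ?_) hi
  rw [HahnSeries.coeff_sub, truncAt, HahnSeries.coeff_truncLT, if_pos (by omega), sub_self]

end DiffOp

end

noncomputable section

namespace SymDivision

open DiffOp

variable {C : Type u} [Field C]

/-! ### Correctness of the algorithm for constant coefficients -/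

/-- The solutions of `q` form the colon space of `m` and `l`. -/
structure IsColonPoly (m l q : C[X]) : Prop where
  natDegree_pos : 0 < l.natDegree
  ne_zero : m ≠ 0
  monic : q.Monic
  natDegree_eq : q.natDegree = colonDim (m.map RatFunc.C) (l.map RatFunc.C)
  solutionSpace_eq : solutionSpace (q.map RatFunc.C) =
    colonSpace (m.map RatFunc.C) (l.map RatFunc.C)

namespace IsColonPoly

theorem symProductDivides [CharZero C] {m l q : C[X]} (hq : IsColonPoly m l q) :
    SymProductDivides (l.map RatFunc.C) (q.map RatFunc.C) (m.map RatFunc.C) :=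
  symProductDivides_map_C (ne_zero_of_natDegree_gt hq.natDegree_pos) hq.monic.ne_zero
    hq.solutionSpace_eq.le

theorem natDegree_le [CharZero C] {m l q : C[X]} (hq : IsColonPoly m l q) {P : DiffOp C}
    (hP : SymProductDivides (l.map RatFunc.C) P (m.map RatFunc.C)) :
    P.natDegree ≤ q.natDegree := by
  rcases eq_or_ne P 0 with rfl | h0
  · rw [natDegree_zero]
    exact Nat.zero_le _
  · exact (natDegree_le_finrank_colonSpace hq.natDegree_pos hq.ne_zero hq.monic hq.natDegree_eq
      hq.solutionSpace_eq h0 hP).1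

theorem eq_map_C [CharZero C] {m l q : C[X]} (hq : IsColonPoly m l q) {P : DiffOp C}
    (hP : SymProductDivides (l.map RatFunc.C) P (m.map RatFunc.C)) (hprim : P.IsPrimitiveOp)
    (hdeg : P.natDegree = q.natDegree) : P = q.map RatFunc.C :=
  (natDegree_le_finrank_colonSpace hq.natDegree_pos hq.ne_zero hq.monic hq.natDegree_eq
    hq.solutionSpace_eq hprim.ne_zero hP).2 hdeg hprim

theorem isQuasiSymmetricQuotient [CharZero C] {m l q : C[X]} (hq : IsColonPoly m l q) :
    IsQuasiSymmetricQuotient (m.map RatFunc.C) (l.map RatFunc.C) (q.map RatFunc.C) := by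
  have hmax : IsMaximalQuotient (m.map RatFunc.C) (l.map RatFunc.C) (q.map RatFunc.C) :=
    ⟨isPrimitiveOp_map_C hq.monic, hq.symProductDivides, fun P hP => by
      rw [natDegree_map]
      exact hq.natDegree_le hP⟩
  refine ⟨hmax, fun Q' hQ' => hq.eq_map_C hQ'.2.1 hQ'.1 ?_⟩
  refine le_antisymm (hq.natDegree_le hQ'.2.1) ?_
  have h1 := hQ'.2.2 _ hmax.2.1
  rwa [natDegree_map] at h1

/-- The quotient has constant coefficients, so every d₀ is an admissible choice and termination has
to hold for all of them. -/
theorem isCoeffDegreeBound [CharZero C] {m l q : C[X]} (hq : IsColonPoly m l q) (δ d₀ : ℕ) :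
    IsCoeffDegreeBound (m.map RatFunc.C) (l.map RatFunc.C) δ d₀ := by
  intro Q hQ _ i
  rw [hQ.2 _ hq.isQuasiSymmetricQuotient.1 |>.symm, coeff_map, RatFunc.num_C, natDegree_C]
  exact Nat.zero_le _

/-- The quotient itself is an approximant. -/
theorem isApproximantAnnihilator [CharZero C] {m l q : C[X]} (hq : IsColonPoly m l q) {d₀ : ℕ}
    {k : ℤ} (hk : (colonDim (m.map RatFunc.C) (l.map RatFunc.C) : ℤ) ≤ k)
    {h : Fin (colonDim (m.map RatFunc.C) (l.map RatFunc.C)) → C⸨X⸩}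
    (hh : IsColonSpaceBasisAt (m.map RatFunc.C) (l.map RatFunc.C) k h) :
    IsApproximantAnnihilator h (fun _ => min (d₀ : ℤ)
      ((k - colonDim (m.map RatFunc.C) (l.map RatFunc.C)) /
        (colonDim (m.map RatFunc.C) (l.map RatFunc.C) + 1))) k (q.map RatFunc.C) := by
  refine ⟨isPrimitiveOp_map_C hq.monic, by rw [natDegree_map, hq.natDegree_eq], fun i => ?_,
    fun j a ha => ?_⟩
  · rw [coeff_map, RatFunc.num_C, natDegree_C]
    -- Here k ≥ δ is needed: for smaller k the rounded quotient is negative and no operator meets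
    -- the degree bounds.
    exact le_min (Nat.cast_nonneg _) (Int.ediv_nonneg (by omega) (by omega))
  · obtain ⟨b, hb⟩ := hh
    rw [hb, ← map_C_map_algebraMap,
      coeff_act_truncAt (by rw [natDegree_map, hq.natDegree_eq]) _ _ ha, map_C_map_algebraMap]
    have h1 : ((b j : C⸨X⸩)) ∈ solutionSpace (q.map RatFunc.C) := by
      rw [hq.solutionSpace_eq]
      exact (b j).2
    rw [mem_solutionSpace.mp h1, HahnSeries.coeff_zero]

/-- At sufficiently high precision, the quotient is the only approximant. -/
theorem eq_of_isApproximantAnnihilator [CharZero C] {m l q : C[X]} (hq : IsColonPoly m l q)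
    {d₀ : ℕ} {k e : ℤ} (hk : (d₀ : ℤ) + colonDim (m.map RatFunc.C) (l.map RatFunc.C) < k)
    {h : Fin (colonDim (m.map RatFunc.C) (l.map RatFunc.C)) → C⸨X⸩}
    (hh : IsColonSpaceBasisAt (m.map RatFunc.C) (l.map RatFunc.C) k h) {Q : DiffOp C}
    (hQ : IsApproximantAnnihilator h (fun _ => min (d₀ : ℤ) e) k Q) : Q = q.map RatFunc.C := by
  obtain ⟨hprim, hdeg, hcoeff, hact⟩ := hQ
  obtain ⟨p, -, -, rfl⟩ := id hprim
  have hinj := RatFunc.algebraMap_injective C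
  rw [natDegree_map_eq_of_injective hinj] at hdeg
  have hd : ∀ i, (p.coeff i).natDegree ≤ d₀ := by
    intro i
    by_cases hi : i < colonDim (m.map RatFunc.C) (l.map RatFunc.C) + 1
    · have h1 := (hcoeff ⟨i, hi⟩).trans (min_le_left _ _)
      rw [coeff_map, RatFunc.num_algebraMap] at h1
      exact_mod_cast h1
    · rw [coeff_eq_zero_of_natDegree_lt (by omega), natDegree_zero]
      exact Nat.zero_le _
  obtain ⟨b, hb⟩ := hh
  -- By linearity the approximate annihilation passes from the truncated basis to all of V(q). Its
  -- precision k - δ exceeds the degree bound d₀.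
  have h1 : ∀ f ∈ solutionSpace (q.map RatFunc.C), ∀ i : ℤ,
      i < (k - colonDim (m.map RatFunc.C) (l.map RatFunc.C)).toNat →
      (act (p.map (algebraMap C[X] (RatFunc C))) f).coeff i = 0 := by
    intro f hf i hi
    have hi' : i < k - colonDim (m.map RatFunc.C) (l.map RatFunc.C) := by omega
    rw [hq.solutionSpace_eq] at hf
    have h2 := congrArg Subtype.val (b.sum_repr ⟨f, hf⟩)
    rw [Submodule.coe_sum] at h2
    change _ = f at h2
    rw [← actLinear_apply, ← h2, map_sum, HahnSeries.coeff_sum]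
    refine Finset.sum_eq_zero fun j _ => ?_
    have h3 := hact j i hi'
    rw [hb, coeff_act_truncAt hdeg _ _ hi'] at h3
    rw [Submodule.coe_smul, map_smul, HahnSeries.coeff_smul, actLinear_apply, h3, smul_zero]
  have h2 := eq_C_mul_of_coeff_act_eq_zero hq.monic (hdeg.trans_eq hq.natDegree_eq.symm) hd
    (by omega) h1
  refine hprim.eq_map_C hq.monic
    (a := algebraMap C[X] (RatFunc C) (p.coeff q.natDegree)) ?_
  conv_lhs => rw [h2]
  rw [Polynomial.map_mul, map_C, map_C_map_algebraMap]

theorem exists_isColonSpaceBasisAt [CharZero C] {m l q : C[X]} (hq : IsColonPoly m l q) (k : ℤ) :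
    ∃ h, IsColonSpaceBasisAt (δ := colonDim (m.map RatFunc.C) (l.map RatFunc.C))
      (m.map RatFunc.C) (l.map RatFunc.C) k h := by
  have := finite_colonSpace hq.natDegree_pos hq.ne_zero
  exact ⟨_, Module.finBasis C _, fun _ => rfl⟩

theorem exists_loopBodyResult [CharZero C] {m l q : C[X]} (hq : IsColonPoly m l q) (d₀ : ℕ)
    (k : ℤ) : ∃ res, LoopBodyResult (m.map RatFunc.C) (l.map RatFunc.C) d₀ k res := by
  obtain ⟨h, hh⟩ := hq.exists_isColonSpaceBasisAt k
  by_cases hex : ∃ Q, IsApproximantAnnihilator h (fun _ => min (d₀ : ℤ)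
      ((k - colonDim (m.map RatFunc.C) (l.map RatFunc.C)) /
        (colonDim (m.map RatFunc.C) (l.map RatFunc.C) + 1))) k Q
  · obtain ⟨Q, hQ⟩ := hex
    exact ⟨some Q, h, hh, hQ⟩
  · exact ⟨none, h, hh, not_exists.mp hex⟩

theorem not_loopBodyResult_none [CharZero C] {m l q : C[X]} (hq : IsColonPoly m l q) {d₀ : ℕ}
    {k : ℤ} (hk : (colonDim (m.map RatFunc.C) (l.map RatFunc.C) : ℤ) ≤ k) :
    ¬ LoopBodyResult (m.map RatFunc.C) (l.map RatFunc.C) d₀ k none :=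
  fun ⟨_, hh, hnone⟩ => hnone _ (hq.isApproximantAnnihilator hk hh)

theorem eq_of_accept [CharZero C] {m l q : C[X]} (hq : IsColonPoly m l q) {d₀ : ℕ} {k : ℤ}
    {Q : DiffOp C} (h : LoopBodyResult (m.map RatFunc.C) (l.map RatFunc.C) d₀ k (some Q))
    (hQ : Q.natDegree = colonDim (m.map RatFunc.C) (l.map RatFunc.C) ∧
      SymProductDivides (l.map RatFunc.C) Q (m.map RatFunc.C)) : Q = q.map RatFunc.C := by
  obtain ⟨_, -, hprim, -⟩ := h
  exact hq.eq_map_C hQ.2 hprim (hQ.1.trans hq.natDegree_eq.symm)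

/-- The operator `N` of the algorithm and the largest root of its indicial polynomial. -/
theorem exists_maxIndicialRoot [CharZero C] {m l q : C[X]} (hq : IsColonPoly m l q)
    (hδ : 0 < colonDim (m.map RatFunc.C) (l.map RatFunc.C)) {P : DiffOp C}
    (hP : IsSymPower (l.map RatFunc.C) (l.natDegree - 1) P) :
    ∃ (N : DiffOp C) (z₀ : ℕ), (∀ N', IsSymProduct (m.map RatFunc.C) P N' ↔ N' = N) ∧
      (∀ z, N.IsMaxIndicialRoot z ↔ z = z₀) ∧
      (l.natDegree - 1) * (l.natDegree - 1) + (l.natDegree - 1) ≤ z₀ := by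
  have hq0 := hq.natDegree_eq
  have hl := hq.natDegree_pos
  have hm : l.natDegree + q.natDegree ≤ m.natDegree + 1 :=
    natDegree_add_le_of_mul_mem hl (by rwa [hq0]) hq.ne_zero fun f hf g hg => by
      rw [hq.solutionSpace_eq] at hg
      have h1 := hg f hf
      rwa [mul_comm] at h1
  obtain ⟨p, rfl, hp⟩ := (exists_isSymPower_map_C hl _).2 P hP
  have hp0 : 0 < p.natDegree := lt_of_lt_of_le (Nat.succ_pos _) hp
  obtain ⟨w, hw, hS, hV⟩ := exists_isSymProduct_map_C hq.ne_zero (ne_zero_of_natDegree_gt hp0)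
  have hwd : m.natDegree + p.natDegree ≤ w.natDegree + 1 :=
    natDegree_add_le_of_mul_mem (by omega) hp0 hw.ne_zero fun f hf g hg => by
      rw [hV]
      exact Submodule.apply_mem_map₂ laurentMul hf hg
  -- With r = ord(L): δ ≥ 1 gives ord(M) ≥ r, and the power has order at least (r-1)² + 1. So ord(N)
  -- ≥ r + (r-1)², and the largest root is ord(N) - 1.
  refine ⟨_, w.natDegree - 1, hS, fun z => ?_, by omega⟩
  rw [isMaxIndicialRoot_map_C hw]
  omega

/-- The initial precision is positive. -/
theorem one_le_precision [CharZero C] {m l q : C[X]} (hq : IsColonPoly m l q)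
    (hδ : 0 < colonDim (m.map RatFunc.C) (l.map RatFunc.C)) {P N : DiffOp C} {z : ℕ}
    (hP : IsSymPower (l.map RatFunc.C) (l.natDegree - 1) P)
    (hN : IsSymProduct (m.map RatFunc.C) P N) (hz : N.IsMaxIndicialRoot z) :
    1 ≤ (z : ℤ) - (l.natDegree : ℤ) * (l.natDegree - 1) / 2 + 1 := by
  obtain ⟨N', z₀, hN', hz', hle⟩ := hq.exists_maxIndicialRoot hδ hP
  rw [(hN' N).mp hN, hz'] at hz
  subst hz
  have hl := hq.natDegree_pos
  obtain ⟨s, hs⟩ : ∃ s, l.natDegree = s + 1 := ⟨l.natDegree - 1, by omega⟩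
  rw [hs, Nat.add_sub_cancel] at hle
  have h1 : (l.natDegree : ℤ) * (l.natDegree - 1) = s * s + s := by
    rw [hs]
    push_cast
    ring
  -- With s = r - 1 the root satisfies z ≥ r(r-1), so subtracting half of r(r-1) leaves a
  -- nonnegative number.
  rw [h1]
  have h2 : (s : ℤ) * s + s ≤ z := by exact_mod_cast hle
  have h4 : (0 : ℤ) ≤ s * s + s := by positivity
  omega

theorem exists_init [CharZero C] {m l q : C[X]} (hq : IsColonPoly m l q)
    (hδ : 0 < colonDim (m.map RatFunc.C) (l.map RatFunc.C)) : ∃ P N z,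
      IsSymPower (l.map RatFunc.C) (l.natDegree - 1) P ∧ IsSymProduct (m.map RatFunc.C) P N ∧
        N.IsMaxIndicialRoot z := by
  obtain ⟨P, hP⟩ := (exists_isSymPower_map_C hq.natDegree_pos (l.natDegree - 1)).1
  obtain ⟨N, z₀, hN, hz, -⟩ := hq.exists_maxIndicialRoot hδ hP
  exact ⟨P, N, z₀, hP, (hN N).mpr rfl, (hz z₀).mpr rfl⟩

/-! ### Termination -/

theorem acc_returned (M L : DiffOp C) (r : Option (DiffOp C)) :
    Acc (fun t s => Step M L s t) (State.returned r) :=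
  ⟨_, fun _ h => nomatch h⟩

theorem acc_running_returned (M L : DiffOp C) (ξ : C) (r : Option (DiffOp C)) :
    Acc (fun t s => Step M L s t) (State.running ξ (.returned r)) := by
  refine ⟨_, fun t h => ?_⟩
  cases h with
  | localStep _ _ _ h => cases h
  | fail => exact acc_returned M L _
  | finish => exact acc_returned M L _

/-- The number n bounds the remaining doublings: since k ≥ 1, doubling raises k by at least one. At
n = 0 the precision exceeds d₀ + δ and a further doubling is impossible. -/
theorem acc_loop [CharZero C] {m l q : C[X]} (hq : IsColonPoly m l q) (ξ : C) (d₀ n : ℕ) :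
    ∀ k : ℤ, 1 ≤ k → (d₀ : ℤ) + colonDim (m.map RatFunc.C) (l.map RatFunc.C) < k + n →
      Acc (fun t s => Step (m.map RatFunc.C) (l.map RatFunc.C) s t)
        (State.running ξ (.loop d₀ k)) := by
  induction n with
  | zero =>
    intro k hk hn
    rw [Nat.cast_zero, add_zero] at hn
    refine ⟨_, fun t h => ?_⟩
    cases h with
    | localStep _ _ t h =>
      rw [shift_map_C, shift_map_C] at h
      cases h with
      | giveUp => exact acc_running_returned _ _ _ _
      | accept => exact acc_running_returned _ _ _ _
      | doubleEmpty _ _ h => exact absurd h (hq.not_loopBodyResult_none (by omega))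
      -- At this precision the approximant is the quotient itself, which passes both acceptance
      -- tests.
      | doubleReject _ _ Q h hQ =>
        obtain ⟨_, hh, hann⟩ := h
        refine absurd ?_ hQ
        rw [hq.eq_of_isApproximantAnnihilator hn hh hann, natDegree_map]
        exact ⟨hq.natDegree_eq, hq.symProductDivides⟩
  | succ n ih =>
    intro k hk hn
    rw [Nat.cast_succ] at hn
    refine ⟨_, fun t h => ?_⟩
    cases h with
    | localStep _ _ t h =>
      rw [shift_map_C, shift_map_C] at h
      cases h with
      | giveUp => exact acc_running_returned _ _ _ _
      | accept => exact acc_running_returned _ _ _ _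
      | doubleEmpty _ _ h => exact ih _ (by omega) (by omega)
      | doubleReject _ _ Q h hQ => exact ih _ (by omega) (by omega)

theorem acc_start [CharZero C] {m l q : C[X]} (hq : IsColonPoly m l q) :
    Acc (fun t s => Step (m.map RatFunc.C) (l.map RatFunc.C) s t) State.start := by
  refine ⟨_, fun t h => ?_⟩
  cases h with
  | choose ξ =>
    refine ⟨_, fun t h => ?_⟩
    cases h with
    | localStep _ _ t h =>
      rw [shift_map_C, shift_map_C] at h
      cases h with
      | dimZero => exact acc_running_returned _ _ _ _
      | init hδ P N z d₀ hP hN hz hd₀ =>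
        rw [natDegree_map] at hP ⊢
        exact hq.acc_loop ξ d₀ (d₀ + colonDim (m.map RatFunc.C) (l.map RatFunc.C)) _
          (hq.one_le_precision hδ hP hN hz) (by
            have := hq.one_le_precision hδ hP hN hz
            push_cast
            omega)

/-! ### Progress and the result -/

/-- The states that can be reached by the algorithm with result `Q`. -/
def IsGoodState (Q : DiffOp C) : State C → Prop
  | .start => True
  | .running _ .start => True
  | .running _ (.loop _ _) => True
  | .running _ (.returned r) => r = some Q
  | .returned r => r = some Q

/-- Partial correctness as an invariant: an accepted operator is the quotient by uniqueness,
whatever the precision, and `none` is never returned. -/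
theorem isGoodState_of_step [CharZero C] {m l q : C[X]} (hq : IsColonPoly m l q) {s t : State C}
    (hs : IsGoodState (q.map RatFunc.C) s)
    (h : Step (m.map RatFunc.C) (l.map RatFunc.C) s t) : IsGoodState (q.map RatFunc.C) t := by
  cases h with
  | choose => trivial
  | fail => exact hs
  | finish ξ Q =>
    have h1 : Q = q.map RatFunc.C := Option.some_injective _ hs
    rw [h1, shift_map_C]
    rfl
  | localStep ξ s t h =>
    rw [shift_map_C, shift_map_C] at h
    cases h with
    | dimZero hδ =>
      have h1 : q = 1 := eq_one_of_monic_natDegree_zero hq.monic (hq.natDegree_eq.trans hδ)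
      change some _ = some _
      rw [h1, Polynomial.map_one]
    | init => trivial
    | giveUp d₀ k h hk =>
      -- The threshold for giving up already implies k ≥ δ, where an approximant always exists.
      refine absurd h (hq.not_loopBodyResult_none (le_trans ?_ hk))
      have : (0 : ℤ) ≤ ((colonDim (m.map RatFunc.C) (l.map RatFunc.C) : ℤ) + 1) * (d₀ + 1) := by
        positivity
      omega
    | accept d₀ k Q h hQ => exact congrArg some (hq.eq_of_accept h hQ)
    | doubleEmpty => trivial
    | doubleReject => trivial

theorem isOrdinaryPoint_map_C (p : C[X]) (ξ : C) : IsOrdinaryPoint (p.map RatFunc.C) ξ := by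
  intro i
  rw [coeff_map, leadingCoeff_map, ← map_div₀, RatFunc.denom_C, eval_one]
  exact one_ne_zero

theorem exists_step_or_eq [CharZero C] {m l q : C[X]} (hq : IsColonPoly m l q) {s : State C}
    (hs : IsGoodState (q.map RatFunc.C) s) :
    (∃ t, Step (m.map RatFunc.C) (l.map RatFunc.C) s t) ∨
      s = State.returned (some (q.map RatFunc.C)) := by
  have hlocal : ∀ (ξ : C) (s t : LocalState C),
      LocalStep (m.map RatFunc.C) (l.map RatFunc.C) s t →
      Step (m.map RatFunc.C) (l.map RatFunc.C) (.running ξ s) (.running ξ t) := by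
    intro ξ s t h
    refine Step.localStep ξ s t ?_
    rwa [shift_map_C, shift_map_C]
  match s with
  | .start =>
    exact Or.inl ⟨_, Step.choose 0 (isOrdinaryPoint_map_C l 0) (isOrdinaryPoint_map_C m 0)⟩
  | .running ξ .start =>
    left
    rcases Nat.eq_zero_or_pos (colonDim (m.map RatFunc.C) (l.map RatFunc.C)) with hδ | hδ
    · exact ⟨_, hlocal ξ _ _ (LocalStep.dimZero hδ)⟩
    · obtain ⟨P, N, z, hP, hN, hz⟩ := hq.exists_init hδ
      -- The degree bound d₀ = 0 is admissible because the quotient has constant coefficients.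
      exact ⟨_, hlocal ξ _ _ (LocalStep.init hδ P N z 0 (by rwa [natDegree_map]) hN hz
        (hq.isCoeffDegreeBound _ _))⟩
  | .running ξ (.loop d₀ k) =>
    left
    obtain ⟨_ | Q, hres⟩ := hq.exists_loopBodyResult d₀ k
    · by_cases hk : ((colonDim (m.map RatFunc.C) (l.map RatFunc.C) : ℤ) + 1) * (d₀ + 1) +
          colonDim (m.map RatFunc.C) (l.map RatFunc.C) ≤ k
      · exact ⟨_, hlocal ξ _ _ (LocalStep.giveUp d₀ k hres hk)⟩
      · exact ⟨_, hlocal ξ _ _ (LocalStep.doubleEmpty d₀ k hres hk)⟩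
    · by_cases hQ : Q.natDegree = colonDim (m.map RatFunc.C) (l.map RatFunc.C) ∧
          SymProductDivides (l.map RatFunc.C) Q (m.map RatFunc.C)
      · exact ⟨_, hlocal ξ _ _ (LocalStep.accept d₀ k Q hres hQ)⟩
      · exact ⟨_, hlocal ξ _ _ (LocalStep.doubleReject d₀ k Q hres hQ)⟩
  | .running ξ (.returned r) =>
    have hr : r = some (q.map RatFunc.C) := hs
    rw [hr]
    exact Or.inl ⟨_, Step.finish ξ _⟩
  | .returned r =>
    have hr : r = some (q.map RatFunc.C) := hs
    rw [hr]
    exact Or.inr rfl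

theorem algorithmReturns [CharZero C] {m l q : C[X]} (hq : IsColonPoly m l q) :
    AlgorithmReturns (m.map RatFunc.C) (l.map RatFunc.C) (q.map RatFunc.C) := by
  refine ⟨hq.acc_start, fun s hs => hq.exists_step_or_eq ?_⟩
  induction hs with
  | refl => trivial
  | tail _ h ih => exact hq.isGoodState_of_step ih h

end IsColonPoly

end SymDivision

end

theorem mainTheorem6 {C : Type u} [Field C] [IsAlgClosed C] [CharZero C] (L M : DiffOp C)
    (hL : L.HasConstCoeffs) (hM : M.HasConstCoeffs)
    (hLord : 0 < L.natDegree) (hMord : 0 < M.natDegree) :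
    ∃ Q : DiffOp C, DiffOp.IsQuasiSymmetricQuotient M L Q ∧ Q.HasConstCoeffs ∧
      SymDivision.AlgorithmReturns M L Q := by
  obtain ⟨l, rfl⟩ := hL
  obtain ⟨m, rfl⟩ := hM
  rw [natDegree_map] at hLord hMord
  have hm : m ≠ 0 := ne_zero_of_natDegree_gt hMord
  obtain ⟨q, hq, hqd, hqV⟩ := DiffOp.exists_solutionSpace_eq_colonSpace hLord hm
  have h : SymDivision.IsColonPoly m l q := ⟨hLord, hm, hq, hqd, hqV⟩
  exact ⟨_, h.isQuasiSymmetricQuotient, ⟨q, rfl⟩, h.algorithmReturns⟩
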